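/- Let $\Theta\subset\mathbb R$ be compact, let $\alpha\in(0,1)$, and let $\gamma:\mathbb R\times[0,1]\times\Theta\to\mathbb R$ satisfy $\gamma(x,0,\theta)=x$ for all $x\in\mathbb R$, $\theta\in\Theta$, together with the following conditions. (C1) For fixed $t\in[0,1]$, $\theta\in\Theta$ the map $x\mapsto\gamma(x,t,\theta)$ is $C^1$, and there is $C_1\ge 1$ such that $C_1^{-1}|x-x'|\le|\gamma(x,t,\theta)-\gamma(x',t,\theta)|\le C_1|x-x'|$ for all $x,x'\in\mathbb R$, $\theta\in\Theta$, $t\in[0,1]$. (C2) There is $C_2>0$ such that $|\gamma(x,t,\theta)-\gamma(x,t',\theta)|\le C_2|t-t'|^{\alpha}$ for all $x\in\mathbb R$, $\theta\in\Theta$, $t,t'\in[0,1]$. (C3) There is $C_3>0$ such that $|\gamma(x,t,\theta)-\gamma(x,t,\theta')|\le C_3|\theta-\theta'|$ for all $x\in\mathbb R$, $t\in[0,1]$, $\theta,\theta'\in\Theta$. Put $\Gamma_{x,t}=\{\gamma(x,t,\theta):\theta\in\Theta\}$, and let $$\beta(\Theta)=\limsup_{\delta\to0^+}\frac{\log N(\delta)}{-\log\delta},$$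 where $N(\delta)$ is the minimum number of closed balls of diameter $\delta$ needed to cover $\Theta$. For $f\in L^2(\mathbb R)$, with $\hat f(\xi)=\int_{\mathbb R}e^{-ix\xi}f(x)\,dx$ (in the sense of Plancherel), write $$e^{it\Delta}f(y)=\frac1{2\pi}\lim_{R\to\infty}\int_{-R}^{R}e^{iy\xi+it\xi^2}\hat f(\xi)\,d\xi$$ whenever this limit exists. Suppose that $f\in H^s(\mathbb R)$ and that one of the following holds: (1) $\alpha\in(1/4,1)$ and $s>\frac{\beta(\Theta)+1}{4}$; (2) $\alpha\in(0,1/4]$ and $s>\alpha\beta(\Theta)+\frac12-\alpha$. Then for almost every $x\in\mathbb R$ the value $e^{it\Delta}f(y)$ exists for all $t\in(0,1]$ and all $y\in\Gamma_{x,t}$, and $$\lim_{\substack{(y,t)\to(x,0)\\ t\in(0,1],\ y\in\Gamma_{x,t}}}e^{it\Delta}f(y)=f(x).$$ -/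

import Mathlib

open Filter Topology MeasureTheory Set
open scoped FourierTransform

namespace TangentialSchrodinger

noncomputable section

/-- The truncated Fourier integral of `e^{itΔ} f` at the point `y`, frequencies `|2πξ| ≤ 2πR`.
With the angular frequency `η = 2πξ` and `fhat(η) = ∫ e^{-ixη} f(x) dx` this is
`(2π)⁻¹ ∫_{|η| ≤ 2πR} e^{iyη + itη²} fhat(η) dη`. Here `𝓕 f` is the Plancherel Fourier transform
of `f ∈ L²(ℝ)`; the integrand is integrable on every bounded interval. -/
def truncatedSchrodinger (f : Lp ℂ 2 (volume : Measure ℝ)) (R t y : ℝ) : ℂ :=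
  ∫ ξ in (-R)..R,
    Complex.exp (Complex.I * ((y * (2 * Real.pi * ξ) + t * (2 * Real.pi * ξ) ^ 2 : ℝ) : ℂ)) *
      (𝓕 f : Lp ℂ 2 (volume : Measure ℝ)) ξ

/-- The Fourier integral of `e^{itΔ} f` at `y` converges to `v`
(as the limit of its symmetric truncations). -/
def HasSchrodingerValue (f : Lp ℂ 2 (volume : Measure ℝ)) (t y : ℝ) (v : ℂ) : Prop :=
  Tendsto (fun R : ℝ => truncatedSchrodinger f R t y) atTop (𝓝 v)

/-- The pointwise value `e^{itΔ} f (y)`; meaningful where the Fourier integral converges. -/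
def schrodinger (f : Lp ℂ 2 (volume : Measure ℝ)) (t y : ℝ) : ℂ :=
  limUnder atTop (fun R : ℝ => truncatedSchrodinger f R t y)

/-- `f ∈ L²(ℝ)` belongs to the Sobolev space `H^s(ℝ)`. -/
def MemHs (s : ℝ) (f : Lp ℂ 2 (volume : Measure ℝ)) : Prop :=
  TemperedDistribution.MemSobolev s 2 (Lp.toTemperedDistribution f)

/-- `N(δ)`: the minimum number of closed balls (of the real line) of diameter `δ`
that cover `Θ`. -/
def ballCoveringNumber (Θ : Set ℝ) (δ : ℝ) : ℕ :=
  (Metric.externalCoveringNumber (δ / 2).toNNReal Θ).toNat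

/-- The logarithmic density (upper Minkowski dimension) `β(Θ)`. -/
def logDensity (Θ : Set ℝ) : ℝ :=
  limsup (fun δ : ℝ => Real.log (ballCoveringNumber Θ δ : ℝ) / (-Real.log δ)) (𝓝[>] (0 : ℝ))

/-- The hypotheses on a family of restricted tangential curves: `γ(x, 0, θ) = x`, bi-Lipschitz and
`C¹` dependence on `x`, `α`-Hölder dependence on `t`, Lipschitz dependence on `θ`. Only the
values of `γ` on `ℝ × [0,1] × Θ` matter. -/
structure IsTangentialFamily (γ : ℝ → ℝ → ℝ → ℝ) (Θ : Set ℝ) (α : ℝ) : Prop where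
  initial : ∀ x : ℝ, ∀ θ ∈ Θ, γ x 0 θ = x
  contDiff : ∀ t ∈ Icc (0 : ℝ) 1, ∀ θ ∈ Θ, ContDiff ℝ 1 (fun x : ℝ => γ x t θ)
  biLipschitz : ∃ C₁ : ℝ, 1 ≤ C₁ ∧ ∀ x x' : ℝ, ∀ θ ∈ Θ, ∀ t ∈ Icc (0 : ℝ) 1,
    C₁⁻¹ * |x - x'| ≤ |γ x t θ - γ x' t θ| ∧ |γ x t θ - γ x' t θ| ≤ C₁ * |x - x'|
  holder : ∃ C₂ : ℝ, 0 < C₂ ∧ ∀ x : ℝ, ∀ θ ∈ Θ, ∀ t ∈ Icc (0 : ℝ) 1, ∀ t' ∈ Icc (0 : ℝ) 1,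
    |γ x t θ - γ x t' θ| ≤ C₂ * |t - t'| ^ α
  lipschitz : ∃ C₃ : ℝ, 0 < C₃ ∧ ∀ x : ℝ, ∀ t ∈ Icc (0 : ℝ) 1, ∀ θ ∈ Θ, ∀ θ' ∈ Θ,
    |γ x t θ - γ x t θ'| ≤ C₃ * |θ - θ'|

/-- `Γ_{x,t} = {γ(x,t,θ) : θ ∈ Θ}`. -/
def curveSection (γ : ℝ → ℝ → ℝ → ℝ) (Θ : Set ℝ) (x t : ℝ) : Set ℝ :=
  (fun θ => γ x t θ) '' Θ

/-- The approach region `{(y,t) : 0 < t ≤ 1, y ∈ Γ_{x,t}}` of the point `(x,0)`. -/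
def approachRegion (γ : ℝ → ℝ → ℝ → ℝ) (Θ : Set ℝ) (x : ℝ) : Set (ℝ × ℝ) :=
  {q | q.2 ∈ Ioc (0 : ℝ) 1 ∧ q.1 ∈ curveSection γ Θ x q.2}

/-- For almost every `x`, `e^{itΔ} f (y)` is defined at all points `(y,t)` of the approach region
of `(x,0)`, and tends to `f x` as `(y,t) → (x,0)` inside that region. -/
def ConvergesAlong (γ : ℝ → ℝ → ℝ → ℝ) (Θ : Set ℝ) (f : Lp ℂ 2 (volume : Measure ℝ)) : Prop :=
  ∀ᵐ x : ℝ,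
    (∀ q ∈ approachRegion γ Θ x, ∃ v : ℂ, HasSchrodingerValue f q.2 q.1 v) ∧
    Tendsto (fun q : ℝ × ℝ => schrodinger f q.2 q.1)
      (𝓝[approachRegion γ Θ x] (x, 0)) (𝓝 (f x))

end

end TangentialSchrodinger

/-! Everything rests on a maximal estimate for frequencies at most Λ, in which the supremum runs
over the time, the parameter θ and also the sharp truncation radius R. For parameters in a piece of
Θ of diameter at most Λ^{-2α}, linearize the supremum and apply the TT* method. The kernel is an
integral of a quadratic phase over a symmetric interval inside [-Λ, Λ], bounded by a multiple of
Λ^{1-2αν}|x-x'|^{-ν} for 1/2 ≤ ν ≤ 1 (`exists_norm_kernel_le`). For ν < 1 this is integrable over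
unit intervals, so a Schur test bounds the squared maximal operator norm by Λ^{1-2αν}.

About Λ^{2αβ(Θ)} such pieces cover Θ. Adding their bounds and letting ν approach 1 gives every
squared-norm exponent q > 1-2α+2αβ(Θ) (`exists_maximal`). On the dyadic shell |ξ| ~ 2^k, membership
in H^s gains 2^{-2sk}. Since s > αβ(Θ)+1/2-α says exactly that 2s exceeds some admissible q, the
shell contributions decay geometrically.

Because R is among the parameters of the supremum, summing the shells gives, for almost every x, a
geometric rate of convergence of the truncated integrals, uniform over the closed region 0 ≤ t ≤ 1
(`ae_exists_geometric_bound`). So the values exist throughout the approach region and are uniform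
limits of functions continuous in (y,t). At t = 0 a subsequence of truncations tends to f(x) by
Plancherel, which identifies the limit; no density argument is needed.

An exponent α > 1/4 is lowered to 1/4, where the two thresholds coincide. -/

namespace TangentialSchrodinger

/-! ### Oscillatory integrals with quadratic phase -/

/-- First derivative test for a quadratic phase. -/
theorem norm_integral_exp_quadratic_le_of_le_abs_deriv {a b u v μ : ℝ} (huv : u ≤ v) (hμ : 0 < μ)
    (h : ∀ ξ ∈ Icc u v, μ ≤ |a + 2 * b * ξ|) :
    ‖∫ ξ in u..v, Complex.exp (Complex.I * ((a * ξ + b * ξ ^ 2 : ℝ) : ℂ))‖ ≤ 4 / μ := by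
  have hne : ∀ ξ ∈ uIcc u v, a + 2 * b * ξ ≠ 0 := fun ξ hξ h0 => by
    have := h ξ (by rwa [uIcc_of_le huv] at hξ)
    rw [h0, abs_zero] at this
    linarith
  have hneC : ∀ ξ ∈ uIcc u v, ((a + 2 * b * ξ : ℝ) : ℂ) ≠ 0 := fun ξ hξ =>
    Complex.ofReal_ne_zero.2 (hne ξ hξ)
  have hder : ∀ ξ : ℝ, HasDerivAt (fun ξ : ℝ => ((a + 2 * b * ξ : ℝ) : ℂ)) ((2 * b : ℝ) : ℂ) ξ := by
    intro ξ
    apply HasDerivAt.ofReal_comp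
    simpa using ((hasDerivAt_id ξ).const_mul (2 * b)).const_add a
  have hexp : ∀ ξ : ℝ, HasDerivAt
      (fun ξ : ℝ => Complex.exp (Complex.I * ((a * ξ + b * ξ ^ 2 : ℝ) : ℂ)))
      (Complex.exp (Complex.I * ((a * ξ + b * ξ ^ 2 : ℝ) : ℂ)) *
        (Complex.I * ((a + 2 * b * ξ : ℝ) : ℂ))) ξ := by
    intro ξ
    have h1 : HasDerivAt (fun ξ : ℝ => a * ξ + b * ξ ^ 2) (a + 2 * b * ξ) ξ := by
      exact (((hasDerivAt_id' ξ).const_mul a).fun_add ((hasDerivAt_pow 2 ξ).const_mul b)).congr_deriv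
        (by norm_num; ring)
    exact (h1.ofReal_comp.const_mul Complex.I).cexp
  -- Integration by parts: with φ the phase, exp(iφ)/(iφ') is a primitive of exp(iφ) up to a
  -- remainder governed by the derivative of 1/φ'.
  have hF : ∀ ξ ∈ uIcc u v, HasDerivAt
      (fun ξ : ℝ => Complex.exp (Complex.I * ((a * ξ + b * ξ ^ 2 : ℝ) : ℂ)) /
        (Complex.I * ((a + 2 * b * ξ : ℝ) : ℂ)))
      (Complex.exp (Complex.I * ((a * ξ + b * ξ ^ 2 : ℝ) : ℂ)) +
        Complex.exp (Complex.I * ((a * ξ + b * ξ ^ 2 : ℝ) : ℂ)) *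
          (Complex.I * (((2 * b) / (a + 2 * b * ξ) ^ 2 : ℝ) : ℂ))) ξ := by
    intro ξ hξ
    have hz := hneC ξ hξ
    refine ((hexp ξ).fun_div ((hder ξ).const_mul Complex.I)
      (mul_ne_zero Complex.I_ne_zero hz)).congr_deriv ?_
    push_cast at hz ⊢
    generalize (a : ℂ) + 2 * b * ξ = z at hz ⊢
    field_simp
    linear_combination (-2 * (b : ℂ)) * Complex.I_sq
  have hG : ∀ ξ ∈ uIcc u v, HasDerivAt (fun ξ : ℝ => -(a + 2 * b * ξ)⁻¹)
      ((2 * b) / (a + 2 * b * ξ) ^ 2) ξ := by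
    intro ξ hξ
    have h1 : HasDerivAt (fun ξ : ℝ => a + 2 * b * ξ) (2 * b) ξ := by
      simpa using ((hasDerivAt_id ξ).const_mul (2 * b)).const_add a
    exact (h1.fun_inv (hne ξ hξ)).fun_neg.congr_deriv (by ring)
  have hc1 : Continuous fun ξ : ℝ => Complex.exp (Complex.I * ((a * ξ + b * ξ ^ 2 : ℝ) : ℂ)) := by
    fun_prop
  have hc2 : ContinuousOn (fun ξ : ℝ => (2 * b) / (a + 2 * b * ξ) ^ 2) (uIcc u v) :=
    ContinuousOn.div (by fun_prop) (by fun_prop) fun ξ hξ => pow_ne_zero 2 (hne ξ hξ)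
  have hc3 : ContinuousOn (fun ξ : ℝ => Complex.exp (Complex.I * ((a * ξ + b * ξ ^ 2 : ℝ) : ℂ)) *
          (Complex.I * (((2 * b) / (a + 2 * b * ξ) ^ 2 : ℝ) : ℂ))) (uIcc u v) :=
    hc1.continuousOn.mul (continuousOn_const.mul (Complex.continuous_ofReal.comp_continuousOn hc2))
  have hnorm : ∀ ξ : ℝ, ‖Complex.exp (Complex.I * ((a * ξ + b * ξ ^ 2 : ℝ) : ℂ))‖ = 1 := fun ξ => by
    rw [mul_comm]; exact Complex.norm_exp_ofReal_mul_I _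
  have hi := intervalIntegral.integral_eq_sub_of_hasDerivAt hF
    ((hc1.continuousOn.add hc3).intervalIntegrable)
  rw [intervalIntegral.integral_add (hc1.continuousOn.intervalIntegrable)
    hc3.intervalIntegrable] at hi
  have hend : ∀ ξ ∈ Icc u v, |(a + 2 * b * ξ)⁻¹| ≤ 1 / μ := fun ξ hξ => by
    rw [abs_inv, ← one_div]
    exact one_div_le_one_div_of_le hμ (h ξ hξ)
  have hendC : ∀ ξ ∈ Icc u v, ‖Complex.exp (Complex.I * ((a * ξ + b * ξ ^ 2 : ℝ) : ℂ)) /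
        (Complex.I * ((a + 2 * b * ξ : ℝ) : ℂ))‖ ≤ 1 / μ := fun ξ hξ => by
    rw [norm_div, hnorm, norm_mul, Complex.norm_I, one_mul, Complex.norm_real, Real.norm_eq_abs]
    exact one_div_le_one_div_of_le hμ (h ξ hξ)
  have hrem : ‖∫ ξ in u..v, Complex.exp (Complex.I * ((a * ξ + b * ξ ^ 2 : ℝ) : ℂ)) *
          (Complex.I * (((2 * b) / (a + 2 * b * ξ) ^ 2 : ℝ) : ℂ))‖ ≤ 2 / μ := by
    -- The derivative of 1/φ' has constant sign, that of -b, so the integral of its absolute value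
    -- is a difference of endpoint values, at most 2/μ.
    obtain ⟨σ, hσ, hσb⟩ : ∃ σ : ℝ, |σ| = 1 ∧ |2 * b| = σ * (2 * b) := by
      rcases le_total 0 (2 * b) with hb | hb
      · exact ⟨1, by simp, by rw [abs_of_nonneg hb]; ring⟩
      · exact ⟨-1, by simp, by rw [abs_of_nonpos hb]; ring⟩
    calc _ ≤ ∫ ξ in u..v, ‖Complex.exp (Complex.I * ((a * ξ + b * ξ ^ 2 : ℝ) : ℂ)) *
          (Complex.I * (((2 * b) / (a + 2 * b * ξ) ^ 2 : ℝ) : ℂ))‖ :=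
          intervalIntegral.norm_integral_le_integral_norm huv
      _ = ∫ ξ in u..v, σ * ((2 * b) / (a + 2 * b * ξ) ^ 2) := by
          congr 1; ext ξ
          rw [norm_mul, hnorm, norm_mul, Complex.norm_I, Complex.norm_real, Real.norm_eq_abs,
            abs_div, hσb, abs_of_nonneg (sq_nonneg (a + 2 * b * ξ))]
          ring
      _ = σ * (-(a + 2 * b * v)⁻¹ - -(a + 2 * b * u)⁻¹) := by
          rw [intervalIntegral.integral_const_mul,
            intervalIntegral.integral_eq_sub_of_hasDerivAt hG hc2.intervalIntegrable]
      _ ≤ |σ * (-(a + 2 * b * v)⁻¹ - -(a + 2 * b * u)⁻¹)| := le_abs_self _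
      _ ≤ 2 / μ := by
          rw [abs_mul, hσ, one_mul]
          have h1 := hend v ⟨huv, le_rfl⟩
          have h2 := hend u ⟨le_rfl, huv⟩
          have h3 : 2 / μ = 1 / μ + 1 / μ := by ring
          rw [abs_le] at *
          constructor <;> linarith [h1.1, h1.2, h2.1, h2.2]
  rw [eq_sub_of_add_eq hi]
  have h1 := hendC v ⟨huv, le_rfl⟩
  have h2 := hendC u ⟨le_rfl, huv⟩
  have h3 : 4 / μ = 1 / μ + 1 / μ + 2 / μ := by ring
  rw [h3]
  exact (norm_sub_le _ _).trans (add_le_add ((norm_sub_le _ _).trans (add_le_add h1 h2)) hrem)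

/-- Second derivative test for a quadratic phase. -/
theorem norm_integral_exp_quadratic_le {a b u v : ℝ} (huv : u ≤ v) (hb : b ≠ 0) :
    ‖∫ ξ in u..v, Complex.exp (Complex.I * ((a * ξ + b * ξ ^ 2 : ℝ) : ℂ))‖ ≤ 6 / √|b| := by
  have hs : 0 < √|b| := Real.sqrt_pos.2 (abs_pos.2 hb)
  have hss : √|b| * √|b| = |b| := Real.mul_self_sqrt (abs_nonneg b)
  set r : ℝ := 1 / √|b| with hr
  have hr0 : 0 < r := by positivity
  set c : ℝ := -a / (2 * b) with hc
  have hac : ∀ ξ, |a + 2 * b * ξ| = 2 * |b| * |ξ - c| := fun ξ => by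
    have : a + 2 * b * ξ = 2 * b * (ξ - c) := by rw [hc]; field_simp; ring
    rw [this, abs_mul, abs_mul, abs_two]
  -- [p, q] is the part of [u, v] within r of the critical point c, with endpoints clipped into [u,
  -- v]. It is estimated by its length; on the two outer pieces |φ'| ≥ 2√|b|.
  set p := max u (min v (c - r)) with hp
  set q := max u (min v (c + r)) with hq
  have hup : u ≤ p := le_max_left _ _
  have hpq : p ≤ q := max_le_max le_rfl (min_le_min le_rfl (by linarith))
  have hqv : q ≤ v := max_le huv (min_le_left _ _)
  have hbr : 2 * |b| * r = 2 * √|b| := by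
    rw [hr]; field_simp; nlinarith
  have hcont : Continuous fun ξ : ℝ => Complex.exp (Complex.I * ((a * ξ + b * ξ ^ 2 : ℝ) : ℂ)) := by
    fun_prop
  have h4 : 4 / (2 * √|b|) = 2 / √|b| := by field_simp; norm_num
  have h1 : ‖∫ ξ in u..p, Complex.exp (Complex.I * ((a * ξ + b * ξ ^ 2 : ℝ) : ℂ))‖ ≤ 2 / √|b| := by
    rcases hup.eq_or_lt with h | h
    · rw [← h]; simp; positivity
    · rw [← h4]
      apply norm_integral_exp_quadratic_le_of_le_abs_deriv hup (by positivity)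
      intro ξ hξ
      have : p ≤ c - r := by
        rcases le_max_iff.1 (le_of_eq hp) with h' | h'
        · exact absurd h' (not_le.2 h)
        · exact h'.trans (min_le_right _ _)
      rw [hac, ← hbr]
      gcongr
      rw [abs_of_nonpos (by linarith [hξ.2])]
      linarith [hξ.2]
  have h2 : ‖∫ ξ in q..v, Complex.exp (Complex.I * ((a * ξ + b * ξ ^ 2 : ℝ) : ℂ))‖ ≤ 2 / √|b| := by
    rcases hqv.eq_or_lt with h | h
    · rw [h]; simp; positivity
    · rw [← h4]
      apply norm_integral_exp_quadratic_le_of_le_abs_deriv hqv (by positivity)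
      intro ξ hξ
      have : c + r ≤ q := by
        have h' : min v (c + r) ≤ q := le_max_right _ _
        rcases min_le_iff.1 h' with h' | h'
        · exact absurd h' (not_le.2 h)
        · exact h'
      rw [hac, ← hbr]
      gcongr
      rw [abs_of_nonneg (by linarith [hξ.1])]
      linarith [hξ.1]
  have h3 : ‖∫ ξ in p..q, Complex.exp (Complex.I * ((a * ξ + b * ξ ^ 2 : ℝ) : ℂ))‖ ≤ 2 / √|b| := by
    refine (intervalIntegral.norm_integral_le_of_norm_le_const (C := 1) fun ξ _ => ?_).trans ?_
    · rw [mul_comm]; exact (Complex.norm_exp_ofReal_mul_I _).le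
    · rw [one_mul, abs_of_nonneg (by linarith)]
      have : 2 / √|b| = 2 * r := by rw [hr]; ring
      rw [this]
      have : q ≤ p + 2 * r := by
        refine max_le (by linarith) ?_
        rcases le_total v (c - r) with h | h
        · have : v ≤ p := by rw [hp, min_eq_left h]; exact le_max_right _ _
          exact (min_le_left _ _).trans (by linarith)
        · have : c - r ≤ p := by rw [hp, min_eq_right h]; exact le_max_right _ _
          exact (min_le_right _ _).trans (by linarith)
      linarith
  have hint := fun x y => hcont.intervalIntegrable (μ := volume) x y
  rw [← intervalIntegral.integral_add_adjacent_intervals (hint u p) (hint p v),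
    ← intervalIntegral.integral_add_adjacent_intervals (hint p q) (hint q v)]
  have h6 : 6 / √|b| = 2 / √|b| + (2 / √|b| + 2 / √|b|) := by ring
  rw [h6]
  exact (norm_add_le _ _).trans (add_le_add h1 ((norm_add_le _ _).trans (add_le_add h3 h2)))

/-! ### Decay of the TT* kernel -/

/-- Interpolation between two upper bounds. -/
theorem le_rpow_mul_rpow_of_le_of_le {K Y Z w : ℝ} (hK : 0 ≤ K) (hY : K ≤ Y) (hZ : K ≤ Z)
    (hw0 : 0 ≤ w) (hw1 : w ≤ 1) : K ≤ Y ^ (1 - w) * Z ^ w := by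
  calc K = K ^ (1 - w) * K ^ w := by
        rw [← Real.rpow_add_of_nonneg hK (by linarith) hw0]; simp
    _ ≤ _ := mul_le_mul (Real.rpow_le_rpow hK hY (by linarith)) (Real.rpow_le_rpow hK hZ hw0)
        (Real.rpow_nonneg hK _) (Real.rpow_nonneg (hK.trans hY) _)

set_option maxHeartbeats 1000000 in
/-- The decay of the `TT*` kernel of the linearized maximal operator. -/
theorem exists_norm_kernel_le {γ : ℝ → ℝ → ℝ → ℝ} {Θ : Set ℝ} {α ν : ℝ} (hα : 0 < α)
    (hα' : α ≤ 1 / 4) (hγ : IsTangentialFamily γ Θ α) (hν : 1 / 2 ≤ ν) (hν' : ν ≤ 1) :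
    ∃ D : ℝ, 0 < D ∧ ∀ Λ : ℝ, 1 ≤ Λ → ∀ ρ ∈ Icc 0 Λ, ∀ x x' : ℝ, x ≠ x' → |x - x'| ≤ 1 →
      ∀ t ∈ Icc (0 : ℝ) 1, ∀ t' ∈ Icc (0 : ℝ) 1, ∀ θ ∈ Θ, ∀ θ' ∈ Θ,
      |θ - θ'| ≤ Λ ^ (-(2 * α)) →
      ‖∫ ξ in (-ρ)..ρ, Complex.exp (Complex.I * (((γ x t θ - γ x' t' θ') * (2 * Real.pi * ξ) +
        (t - t') * (2 * Real.pi * ξ) ^ 2 : ℝ) : ℂ))‖ ≤ D * (Λ ^ (1 - 2 * α * ν) * |x - x'| ^ (-ν)) := by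
  obtain ⟨C₁, hC₁, hL⟩ := hγ.biLipschitz
  obtain ⟨C₂, hC₂, hH⟩ := hγ.holder
  obtain ⟨C₃, hC₃, hT⟩ := hγ.lipschitz
  have hπ := Real.pi_pos
  have hC₁0 : 0 < C₁ := by linarith
  -- A and c are chosen so that, once the first two cases below are excluded, the displacements due
  -- to θ and to t each cost at most r/(4C₁) of the bi-Lipschitz lower bound r/C₁.
  set A : ℝ := 4 * C₁ * C₃ with hA
  have hA0 : 0 < A := by positivity
  set c : ℝ := 1 / (4 * C₁ * C₂) with hc
  have hc0 : 0 < c := by positivity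
  set D₁ : ℝ := 2 * A ^ ν
  set D₂ : ℝ := 2 ^ (1 - ν) * (8 * C₁) ^ ν
  set D₃ : ℝ := 2 ^ (1 - 2 * α * ν) * (6 ^ (2 * α * ν) * c ^ (-ν))
  set D₄ : ℝ := 6 * (16 * Real.pi * C₁) ^ (1 / 2 : ℝ)
  have hD₁ : 0 < D₁ := by positivity
  have hD₂ : 0 < D₂ := by positivity
  have hD₃ : 0 < D₃ := by positivity
  have hD₄ : 0 < D₄ := by positivity
  refine ⟨D₁ + D₂ + D₃ + D₄, by positivity, ?_⟩
  intro Λ hΛ ρ hρ x x' hxx hx1 t ht t' ht' θ hθ θ' hθ' hθθ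
  have hΛ0 : 0 < Λ := by linarith
  set r := |x - x'| with hr
  have hr0 : 0 < r := abs_pos.2 (sub_ne_zero.2 hxx)
  set τ := |t - t'| with hτ
  have hτ0 : 0 ≤ τ := abs_nonneg _
  set S : ℝ := Λ ^ (1 - 2 * α * ν) * r ^ (-ν) with hS
  have hS0 : 0 < S := by positivity
  have hρρ : -ρ ≤ ρ := by linarith [hρ.1]
  set a : ℝ := (γ x t θ - γ x' t' θ') * (2 * Real.pi) with ha
  set b : ℝ := (t - t') * (4 * Real.pi ^ 2) with hb
  have hph : ∀ ξ : ℝ, (γ x t θ - γ x' t' θ') * (2 * Real.pi * ξ) +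
        (t - t') * (2 * Real.pi * ξ) ^ 2 = a * ξ + b * ξ ^ 2 := fun ξ => by rw [ha, hb]; ring
  simp_rw [hph]
  set K := ‖∫ ξ in (-ρ)..ρ, Complex.exp (Complex.I * ((a * ξ + b * ξ ^ 2 : ℝ) : ℂ))‖ with hK
  have hK0 : 0 ≤ K := norm_nonneg _
  have hKΛ : K ≤ 2 * Λ := by
    refine (intervalIntegral.norm_integral_le_of_norm_le_const (C := 1) fun ξ _ => ?_).trans ?_
    · rw [mul_comm]; exact (Complex.norm_exp_ofReal_mul_I _).le
    · rw [one_mul, abs_of_nonneg (by linarith)]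
      linarith [hρ.2]
  have hαν : 2 * α * ν ≤ 1 / 2 := by nlinarith
  have hαν0 : 0 ≤ 2 * α * ν := by positivity
  suffices h : K ≤ D₁ * S ∨ K ≤ D₂ * S ∨ K ≤ D₃ * S ∨ K ≤ D₄ * S by
    have h1 := mul_pos hD₁ hS0
    have h2 := mul_pos hD₂ hS0
    have h3 := mul_pos hD₃ hS0
    have h4 := mul_pos hD₄ hS0
    have : (D₁ + D₂ + D₃ + D₄) * S = D₁ * S + D₂ * S + D₃ * S + D₄ * S := by ring
    rcases h with h | h | h | h <;> linarith
  have hKτ : 0 < τ → K ≤ 6 * τ ^ (-(1 / 2) : ℝ) := by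
    intro hτp
    have hb0 : b ≠ 0 := mul_ne_zero (abs_pos.1 hτp) (by positivity)
    refine (norm_integral_exp_quadratic_le hρρ hb0).trans ?_
    rw [Real.rpow_neg hτ0, ← Real.sqrt_eq_rpow, ← div_eq_mul_inv]
    have : τ ≤ |b| := by
      rw [hb, abs_mul, abs_of_pos (by positivity : 0 < 4 * Real.pi ^ 2)]
      have : 1 ≤ 4 * Real.pi ^ 2 := by nlinarith [Real.pi_gt_three]
      nlinarith
    have := Real.sqrt_pos.2 hτp
    gcongr
  -- Very close points: the trivial bound 2Λ suffices.
  by_cases h1 : r ≤ A * Λ ^ (-(2 * α))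
  · left
    refine hKΛ.trans ?_
    have h2 : Λ ^ (2 * α) ≤ A * r⁻¹ := by
      rw [Real.rpow_neg hΛ0.le, ← div_eq_mul_inv, le_div_iff₀ (by positivity)] at h1
      rw [← div_eq_mul_inv, le_div_iff₀ hr0]
      linarith
    have h3 : Λ = Λ ^ (1 - 2 * α * ν) * (Λ ^ (2 * α)) ^ ν := by
      rw [← Real.rpow_mul hΛ0.le, ← Real.rpow_add hΛ0]; simp
    calc 2 * Λ = 2 * (Λ ^ (1 - 2 * α * ν) * (Λ ^ (2 * α)) ^ ν) := by rw [← h3]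
      _ ≤ 2 * (Λ ^ (1 - 2 * α * ν) * (A * r⁻¹) ^ ν) := by gcongr
      _ = D₁ * S := by
        rw [Real.mul_rpow hA0.le (by positivity), Real.inv_rpow hr0.le, ← Real.rpow_neg hr0.le, hS]
        ring
  right
  push Not at h1
  -- Large time separation: the second derivative test gives τ^{-1/2}, interpolated with 2Λ at
  -- weight 2αν so that τ^{-αν} turns into r^{-ν}.
  by_cases h2 : c * r ≤ τ ^ α
  · right; left
    have hτp : 0 < τ := by
      rcases hτ0.eq_or_lt with h | h
      · rw [← h, Real.zero_rpow hα.ne'] at h2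
        exact absurd h2 (not_le.2 (by positivity))
      · exact h
    refine (le_rpow_mul_rpow_of_le_of_le hK0 hKΛ (hKτ hτp) hαν0 (by linarith)).trans ?_
    have h3 : (τ ^ (-(1 / 2) : ℝ)) ^ (2 * α * ν) ≤ (c * r) ^ (-ν) := by
      rw [← Real.rpow_mul hτ0]
      have : -(1 / 2) * (2 * α * ν) = α * (-ν) := by ring
      rw [this, Real.rpow_mul hτ0]
      exact Real.rpow_le_rpow_of_nonpos (by positivity) h2 (by linarith)
    rw [Real.mul_rpow (by norm_num) hΛ0.le, Real.mul_rpow (by norm_num) (by positivity)]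
    rw [Real.mul_rpow hc0.le hr0.le] at h3
    calc _ ≤ 2 ^ (1 - 2 * α * ν) * Λ ^ (1 - 2 * α * ν) *
          (6 ^ (2 * α * ν) * (c ^ (-ν) * r ^ (-ν))) := by gcongr
      _ = D₃ * S := by rw [hS]; ring
  push Not at h2
  -- A critical point may lie in the frequency range: the second derivative test gives (Λ/r)^{1/2}.
  -- This is absorbed because α ≤ 1/4 and ν ≤ 1 force 1-2αν ≥ 1/2, while ν ≥ 1/2 and r ≤ 1.
  by_cases h3 : r / (16 * Real.pi * C₁ * Λ) ≤ τ
  · right; right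
    have hτp : 0 < τ := lt_of_lt_of_le (by positivity) h3
    refine (hKτ hτp).trans ?_
    calc 6 * τ ^ (-(1 / 2) : ℝ) ≤ 6 * (r / (16 * Real.pi * C₁ * Λ)) ^ (-(1 / 2) : ℝ) := by
          gcongr 6 * ?_
          exact Real.rpow_le_rpow_of_nonpos (by positivity) h3 (by norm_num)
      _ = D₄ * (Λ ^ (1 / 2 : ℝ) * r ^ (-(1 / 2) : ℝ)) := by
          rw [Real.div_rpow hr0.le (by positivity),
            Real.mul_rpow (by positivity : 0 ≤ 16 * Real.pi * C₁) hΛ0.le,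
            Real.rpow_neg (by positivity : 0 ≤ 16 * Real.pi * C₁), Real.rpow_neg hΛ0.le]
          simp only [D₄]
          field_simp
      _ ≤ D₄ * S := by
          rw [hS]
          gcongr D₄ * (?_ * ?_)
          · exact Real.rpow_le_rpow_of_exponent_le hΛ (by linarith)
          · exact Real.rpow_le_rpow_of_exponent_ge hr0 hx1 (by linarith)
  push Not at h3
  left
  -- Remaining case: the spatial separation dominates and the phase has no critical point, so the
  -- first derivative test gives 1/r, interpolated with 2Λ at weight ν.
  have hy : r / (2 * C₁) ≤ |γ x t θ - γ x' t' θ'| := by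
    have e1 := (hL x x' θ hθ t ht).1
    have e2 := hH x' θ hθ t ht t' ht'
    have e3 := hT x' t' ht' θ hθ θ' hθ'
    have e4 : C₂ * τ ^ α ≤ r / (4 * C₁) := by
      have : c * r * C₂ = r / (4 * C₁) := by rw [hc]; field_simp
      rw [← this]; nlinarith
    have e5 : C₃ * |θ - θ'| ≤ r / (4 * C₁) := by
      rw [le_div_iff₀ (by positivity)]
      have : A * |θ - θ'| ≤ A * Λ ^ (-(2 * α)) := by gcongr
      have e : A * |θ - θ'| = C₃ * |θ - θ'| * (4 * C₁) := by rw [hA]; ring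
      linarith
    have e6 : C₁⁻¹ * r = r / (2 * C₁) + r / (4 * C₁) + r / (4 * C₁) := by field_simp; norm_num
    have e7 : |γ x t θ - γ x' t θ| ≤ |γ x t θ - γ x' t' θ'| + |γ x' t θ - γ x' t' θ| +
        |γ x' t' θ - γ x' t' θ'| := by
      have : γ x t θ - γ x' t θ = (γ x t θ - γ x' t' θ') - (γ x' t θ - γ x' t' θ) -
        (γ x' t' θ - γ x' t' θ') := by ring
      rw [this]
      exact (abs_sub _ _).trans (add_le_add_left (abs_sub _ _) _)
    linarith
  have hK2 : K ≤ 8 * C₁ * r⁻¹ := by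
    have h4 : K ≤ 4 / (Real.pi * r / (2 * C₁)) := by
      refine norm_integral_exp_quadratic_le_of_le_abs_deriv hρρ (by positivity) fun ξ hξ => ?_
      have e1 : |a| = 2 * Real.pi * |γ x t θ - γ x' t' θ'| := by
        rw [ha, abs_mul, abs_of_pos (by positivity : 0 < 2 * Real.pi)]; ring
      have e2 : |2 * b * ξ| ≤ 8 * Real.pi ^ 2 * (τ * Λ) := by
        rw [abs_mul, abs_mul, hb, abs_mul, abs_two,
          abs_of_pos (by positivity : 0 < 4 * Real.pi ^ 2)]
        have : |ξ| ≤ Λ := abs_le.2 ⟨by linarith [hξ.1, hρ.2], by linarith [hξ.2, hρ.2]⟩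
        calc 2 * (τ * (4 * Real.pi ^ 2)) * |ξ| ≤ 2 * (τ * (4 * Real.pi ^ 2)) * Λ := by gcongr
          _ = _ := by ring
      have e3 : 8 * Real.pi ^ 2 * (τ * Λ) ≤ Real.pi * r / (2 * C₁) := by
        have : τ * Λ ≤ r / (16 * Real.pi * C₁) := by
          rw [le_div_iff₀ (by positivity)]
          rw [lt_div_iff₀ (by positivity)] at h3
          linarith
        calc _ ≤ 8 * Real.pi ^ 2 * (r / (16 * Real.pi * C₁)) := by gcongr
          _ = _ := by field_simp; norm_num
      have e4 : 2 * Real.pi * (r / (2 * C₁)) ≤ |a| := by rw [e1]; gcongr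
      have e5 : 2 * Real.pi * (r / (2 * C₁)) = Real.pi * r / (2 * C₁) + Real.pi * r / (2 * C₁) := by
        ring
      have e6 := abs_sub_abs_le_abs_sub a (-(2 * b * ξ))
      rw [abs_neg, sub_neg_eq_add] at e6
      linarith
    refine h4.trans ?_
    have : 4 / (Real.pi * r / (2 * C₁)) = 8 * C₁ * r⁻¹ / Real.pi := by field_simp; norm_num
    rw [this]
    exact div_le_self (by positivity) (by linarith [Real.pi_gt_three])
  refine (le_rpow_mul_rpow_of_le_of_le hK0 hKΛ hK2 (by linarith) hν').trans ?_
  rw [Real.mul_rpow (by norm_num) hΛ0.le, Real.mul_rpow (by positivity) (by positivity),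
    Real.inv_rpow hr0.le, ← Real.rpow_neg hr0.le]
  calc _ ≤ 2 ^ (1 - ν) * Λ ^ (1 - 2 * α * ν) * ((8 * C₁) ^ ν * r ^ (-ν)) := by
        gcongr
        nlinarith
    _ = D₂ * S := by rw [hS]; ring

/-! ### The TT* method and linearization of suprema -/

open scoped ComplexConjugate ENNReal in
/-- The `TT*` method: a Schur bound for the kernel of `T T*` bounds `T` on `L²`. -/
theorem lintegral_enorm_sq_le_of_kernel {X Y : Type*} [MeasurableSpace X] [MeasurableSpace Y]
    {μ : Measure X} {ν : Measure Y} [IsFiniteMeasure μ] [IsFiniteMeasure ν]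
    {e : X → Y → ℂ} (he : Measurable (Function.uncurry e)) (he1 : ∀ x y, ‖e x y‖ ≤ 1)
    {h : Y → ℂ} (hh : MemLp h 2 ν) {k : X → X → ℝ≥0∞} (hk : Measurable (Function.uncurry k))
    (hK : ∀ x x', ‖∫ y, e x y * conj (e x' y) ∂ν‖ₑ ≤ k x x') {b : ℝ} (hb : 0 < b)
    (hB : ∀ᵐ x ∂μ, ∫⁻ x', k x x' ∂μ ≤ ENNReal.ofReal b)
    (hB' : ∀ᵐ x' ∂μ, ∫⁻ x, k x x' ∂μ ≤ ENNReal.ofReal b) :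
    ∫⁻ x, ‖∫ y, e x y * h y ∂ν‖ₑ ^ 2 ∂μ ≤ ENNReal.ofReal (2 * b) * ∫⁻ y, ‖h y‖ₑ ^ 2 ∂ν := by
  set A : X → ℂ := fun x => ∫ y, e x y * h y ∂ν
  have hhi : Integrable h ν := hh.integrable (by norm_num)
  have hAm : AEStronglyMeasurable A μ := by
    have : AEStronglyMeasurable (fun p : X × Y => e p.1 p.2 * h p.2) (μ.prod ν) :=
      he.aestronglyMeasurable.mul hhi.1.comp_snd
    exact this.integral_prod_right'
  set H : ℝ := ∫ y, ‖h y‖ ∂ν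
  have hAH : ∀ x, ‖A x‖ ≤ H := fun x => by
    refine norm_integral_le_of_norm_le hhi.norm (Eventually.of_forall fun y => ?_)
    rw [norm_mul]
    exact mul_le_of_le_one_left (norm_nonneg _) (he1 x y)
  have hH0 : 0 ≤ H := integral_nonneg fun y => norm_nonneg _
  set G : Y → ℂ := fun y => ∫ x, conj (A x) * e x y ∂μ with hG
  have hcA : AEStronglyMeasurable (fun x => conj (A x)) μ :=
    Complex.continuous_conj.comp_aestronglyMeasurable hAm
  have hGm : AEStronglyMeasurable G ν := by
    have : AEStronglyMeasurable (fun p : Y × X => conj (A p.2) * e p.2 p.1) (ν.prod μ) :=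
      hcA.comp_snd.mul (he.comp measurable_swap).aestronglyMeasurable
    exact this.integral_prod_right'
  have hGH : ∀ y, ‖G y‖ ≤ H * μ.real univ := fun y => by
    refine norm_integral_le_of_norm_le_const (Eventually.of_forall fun x => ?_)
    rw [norm_mul, RCLike.norm_conj]
    exact (mul_le_of_le_one_right (norm_nonneg _) (he1 x y)).trans (hAH x)
  set M : ℝ := ∫ x, ‖A x‖ ^ 2 ∂μ with hM
  have hM0 : 0 ≤ M := integral_nonneg fun y => by positivity
  have hA2 : Integrable (fun x => ‖A x‖ ^ 2) μ := by
    refine Integrable.of_bound (hAm.norm.pow 2) (H ^ 2) (Eventually.of_forall fun x => ?_)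
    rw [norm_pow, norm_norm]
    gcongr
    exact hAH x
  have hG2 : Integrable (fun x => ‖G x‖ ^ 2) ν := by
    refine Integrable.of_bound (hGm.norm.pow 2) ((H * μ.real univ) ^ 2)
      (Eventually.of_forall fun x => ?_)
    rw [norm_pow, norm_norm]
    gcongr
    exact hGH x
  have hh2 : Integrable (fun x => ‖h x‖ ^ 2) ν := hh.integrable_norm_pow (by norm_num)
  have hMl : ∫⁻ x, ‖A x‖ₑ ^ 2 ∂μ = ENNReal.ofReal M := by
    rw [hM, ofReal_integral_eq_lintegral_ofReal hA2 (Eventually.of_forall fun x => by positivity)]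
    simp_rw [ENNReal.ofReal_pow (norm_nonneg _), ofReal_norm]
  have hhl : ∫⁻ x, ‖h x‖ₑ ^ 2 ∂ν = ENNReal.ofReal (∫ y, ‖h y‖ ^ 2 ∂ν) := by
    rw [ofReal_integral_eq_lintegral_ofReal hh2 (Eventually.of_forall fun x => by positivity)]
    simp_rw [ENNReal.ofReal_pow (norm_nonneg _), ofReal_norm]
  have step1 : (M : ℂ) = ∫ y, h y * G y ∂ν := by
    have hint : Integrable (fun p : X × Y => conj (A p.1) * (e p.1 p.2 * h p.2)) (μ.prod ν) := by
      have h1 : Integrable (fun p : X × Y => h p.2) (μ.prod ν) := hhi.comp_snd μ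
      have h2 := h1.bdd_mul (c := H) (f := fun p : X × Y => conj (A p.1) * e p.1 p.2)
        (hcA.comp_fst.mul he.aestronglyMeasurable) (Eventually.of_forall fun p => by
          rw [norm_mul, RCLike.norm_conj]
          exact (mul_le_of_le_one_right (norm_nonneg _) (he1 _ _)).trans (hAH _))
      refine h2.congr (Eventually.of_forall fun p => ?_)
      simp only [mul_assoc]
    calc (M : ℂ) = ∫ x, ((‖A x‖ ^ 2 : ℝ) : ℂ) ∂μ := by rw [hM, integral_complex_ofReal]
      _ = ∫ x, ∫ y, conj (A x) * (e x y * h y) ∂ν ∂μ := by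
          congr 1; ext x
          rw [integral_const_mul, mul_comm, Complex.mul_conj, Complex.normSq_eq_norm_sq]
      _ = ∫ y, ∫ x, conj (A x) * (e x y * h y) ∂μ ∂ν := integral_integral_swap hint
      _ = ∫ y, h y * G y ∂ν := by
          congr 1; ext y
          rw [hG, ← integral_const_mul]
          congr 1; ext x; ring
  -- G is the conjugate of the adjoint operator applied to A. Expanding |G|² produces the kernel,
  -- and |A(x)A(x')| ≤ |A(x)|² + |A(x')|² reduces the double integral to the row and column bounds;
  -- this accounts for the factor 2.
  have step2 : ∫ y, ‖G y‖ ^ 2 ∂ν ≤ 2 * b * M := by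
    have hint : Integrable (fun q : Y × (X × X) => (conj (A q.2.1) * e q.2.1 q.1) *
        (A q.2.2 * conj (e q.2.2 q.1))) (ν.prod (μ.prod μ)) := by
      refine Integrable.of_bound ?_ (H * H) (Eventually.of_forall fun q => ?_)
      · refine (AEStronglyMeasurable.mul ?_ ?_).mul (AEStronglyMeasurable.mul ?_ ?_)
        · exact hcA.comp_fst.comp_snd
        · exact (he.comp ((measurable_fst.comp measurable_snd).prodMk
            measurable_fst)).aestronglyMeasurable
        · exact hAm.comp_snd.comp_snd
        · exact (Complex.continuous_conj.measurable.comp (he.comp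
            ((measurable_snd.comp measurable_snd).prodMk measurable_fst))).aestronglyMeasurable
      · simp only [norm_mul, RCLike.norm_conj]
        gcongr
        · exact (mul_le_of_le_one_right (norm_nonneg _) (he1 _ _)).trans (hAH _)
        · exact (mul_le_of_le_one_right (norm_nonneg _) (he1 _ _)).trans (hAH _)
    have e1 : ((∫ y, ‖G y‖ ^ 2 ∂ν : ℝ) : ℂ) = ∫ p : X × X, conj (A p.1) * A p.2 *
        ∫ y, e p.1 y * conj (e p.2 y) ∂ν ∂(μ.prod μ) := by
      calc ((∫ y, ‖G y‖ ^ 2 ∂ν : ℝ) : ℂ) = ∫ y, ((‖G y‖ ^ 2 : ℝ) : ℂ) ∂ν := by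
            rw [integral_complex_ofReal]
        _ = ∫ y, ∫ p : X × X, (conj (A p.1) * e p.1 y) * (A p.2 * conj (e p.2 y))
              ∂(μ.prod μ) ∂ν := by
            congr 1; ext y
            rw [integral_prod_mul (fun x => conj (A x) * e x y) (fun x => A x * conj (e x y))]
            have : ∫ x, A x * conj (e x y) ∂μ = conj (G y) := by
              rw [hG, ← integral_conj]
              simp
            rw [this, Complex.mul_conj, Complex.normSq_eq_norm_sq]
        _ = ∫ p : X × X, ∫ y, (conj (A p.1) * e p.1 y) * (A p.2 * conj (e p.2 y)) ∂ν
              ∂(μ.prod μ) := integral_integral_swap hint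
        _ = _ := by
            congr 1; ext p
            rw [← integral_const_mul]
            congr 1; ext y; ring
    have e2 : ENNReal.ofReal (∫ y, ‖G y‖ ^ 2 ∂ν) ≤ ENNReal.ofReal (2 * b * M) := by
      have e3 : ENNReal.ofReal (∫ y, ‖G y‖ ^ 2 ∂ν) = ‖((∫ y, ‖G y‖ ^ 2 ∂ν : ℝ) : ℂ)‖ₑ := by
        rw [← ofReal_norm, Complex.norm_real, Real.norm_of_nonneg]
        exact integral_nonneg fun y => by positivity
      rw [e3, e1]
      have hAe : AEMeasurable (fun x => ‖A x‖ₑ ^ 2) μ := hAm.enorm.pow_const 2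
      calc _ ≤ ∫⁻ p : X × X, ‖conj (A p.1) * A p.2 *
              ∫ y, e p.1 y * conj (e p.2 y) ∂ν‖ₑ ∂(μ.prod μ) := enorm_integral_le_lintegral_enorm _
        _ ≤ ∫⁻ p : X × X, (‖A p.1‖ₑ ^ 2 * k p.1 p.2 + ‖A p.2‖ₑ ^ 2 * k p.1 p.2) ∂(μ.prod μ) := by
            refine lintegral_mono fun p => ?_
            rw [← add_mul, enorm_mul, enorm_mul]
            have hc : ‖conj (A p.1)‖ₑ = ‖A p.1‖ₑ := by
              rw [← ofReal_norm, RCLike.norm_conj, ofReal_norm]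
            rw [hc]
            refine mul_le_mul' ?_ (hK _ _)
            rcases le_total ‖A p.1‖ₑ ‖A p.2‖ₑ with hle | hle
            · exact (mul_le_mul_left hle _).trans ((sq _).symm.le.trans le_add_self)
            · exact (mul_le_mul_right hle _).trans ((sq _).symm.le.trans le_self_add)
        _ = ∫⁻ p : X × X, ‖A p.1‖ₑ ^ 2 * k p.1 p.2 ∂(μ.prod μ) +
              ∫⁻ p : X × X, ‖A p.2‖ₑ ^ 2 * k p.1 p.2 ∂(μ.prod μ) :=
            lintegral_add_left' (hAe.comp_fst.mul hk.aemeasurable) _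
        _ = ∫⁻ x, ∫⁻ x', ‖A x‖ₑ ^ 2 * k x x' ∂μ ∂μ + ∫⁻ x', ∫⁻ x, ‖A x'‖ₑ ^ 2 * k x x' ∂μ ∂μ := by
            exact congrArg₂ (· + ·) (lintegral_prod _ (hAe.comp_fst.mul hk.aemeasurable))
              (lintegral_prod_symm _ (hAe.comp_snd.mul hk.aemeasurable))
        _ ≤ ∫⁻ x, ‖A x‖ₑ ^ 2 * ENNReal.ofReal b ∂μ + ∫⁻ x, ‖A x‖ₑ ^ 2 * ENNReal.ofReal b ∂μ := by
            gcongr ?_ + ?_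
            · refine lintegral_mono_ae (hB.mono fun x hx => ?_)
              have hkx : Measurable fun x' => k x x' := hk.comp measurable_prodMk_left
              rw [lintegral_const_mul _ hkx]
              gcongr
            · refine lintegral_mono_ae (hB'.mono fun x hx => ?_)
              have hkx : Measurable fun x' => k x' x := hk.comp measurable_prodMk_right
              rw [lintegral_const_mul _ hkx]
              gcongr
        _ = ENNReal.ofReal (2 * b * M) := by
            rw [lintegral_mul_const'' _ hAe, hMl, ← two_mul, ← ENNReal.ofReal_mul hM0]
            rw [mul_assoc, ENNReal.ofReal_mul (by norm_num : (0:ℝ) ≤ 2), mul_comm M]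
            simp
    exact (ENNReal.ofReal_le_ofReal_iff (by positivity)).1 e2
  have step3 : M ≤ 2 * b * ∫ y, ‖h y‖ ^ 2 ∂ν := by
    have e1 : M = ‖∫ y, h y * G y ∂ν‖ := by
      rw [← step1, Complex.norm_real, Real.norm_of_nonneg hM0]
    -- Young's inequality with weights b and 1/(4b): by `step2` the G term is at most M/2, and it is
    -- absorbed on the left since M is a finite real.
    have e2 : ‖∫ y, h y * G y ∂ν‖ ≤ ∫ y, (b * ‖h y‖ ^ 2 + (4 * b)⁻¹ * ‖G y‖ ^ 2) ∂ν := by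
      refine norm_integral_le_of_norm_le ((hh2.const_mul _).add (hG2.const_mul _))
        (Eventually.of_forall fun y => ?_)
      rw [norm_mul]
      have : b * ‖h y‖ ^ 2 + (4 * b)⁻¹ * ‖G y‖ ^ 2 - ‖h y‖ * ‖G y‖ =
          b * (‖h y‖ - (2 * b)⁻¹ * ‖G y‖) ^ 2 := by field_simp; ring
      have h0 : 0 ≤ b * (‖h y‖ - (2 * b)⁻¹ * ‖G y‖) ^ 2 := by positivity
      linarith
    rw [integral_add (hh2.const_mul _) (hG2.const_mul _), integral_const_mul, integral_const_mul,
      ← e1] at e2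
    have e3 : (4 * b)⁻¹ * ∫ y, ‖G y‖ ^ 2 ∂ν ≤ (4 * b)⁻¹ * (2 * b * M) := by gcongr
    have e4 : (4 * b)⁻¹ * (2 * b * M) = M / 2 := by field_simp; norm_num
    linarith
  rw [hMl, hhl, ← ENNReal.ofReal_mul (by positivity)]
  exact ENNReal.ofReal_le_ofReal step3

/-- A measurable choice of an index at which the first `N + 1` functions attain their maximum. -/
theorem exists_measurable_argmax {X : Type*} [MeasurableSpace X] {F : ℕ → X → ENNReal}
    (hF : ∀ n, Measurable (F n)) (N : ℕ) :
    ∃ j : X → ℕ, Measurable j ∧ ∀ n ≤ N, ∀ x, F n x ≤ F (j x) x := by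
  induction N with
  | zero => exact ⟨fun _ => 0, measurable_const, fun n hn x => by rw [Nat.le_zero.1 hn]⟩
  | succ N ih =>
    obtain ⟨j, hj, hj'⟩ := ih
    have hFj : Measurable fun x => F (j x) x :=
      (measurable_from_prod_countable_right (f := fun p : ℕ × X => F p.1 p.2) hF).comp
        (hj.prodMk measurable_id)
    classical
    refine ⟨fun x => if F (j x) x ≤ F (N + 1) x then N + 1 else j x,
      Measurable.ite (measurableSet_le hFj (hF _)) measurable_const hj, fun n hn x => ?_⟩
    by_cases h : F (j x) x ≤ F (N + 1) x
    · simp only [h, if_true]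
      rcases Nat.le_succ_iff.1 hn with h' | h'
      · exact (hj' n h' x).trans h
      · rw [h']
    · simp only [h, if_false]
      rcases Nat.le_succ_iff.1 hn with h' | h'
      · exact hj' n h' x
      · rw [h']; exact (not_le.1 h).le

/-- A bound for all measurable selections from a sequence bounds the supremum. -/
theorem lintegral_iSup_le_of_measurable_selection {X : Type*} [MeasurableSpace X] {μ : Measure X}
    {F : ℕ → X → ENNReal} (hF : ∀ n, Measurable (F n)) {B : ENNReal}
    (hB : ∀ j : X → ℕ, Measurable j → ∫⁻ x, F (j x) x ∂μ ≤ B) : ∫⁻ x, ⨆ n, F n x ∂μ ≤ B := by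
  choose j hj hjF using exists_measurable_argmax hF
  have hFj : ∀ N, Measurable fun x => F (j N x) x := fun N =>
    (measurable_from_prod_countable_right (f := fun p : ℕ × X => F p.1 p.2) hF).comp
      ((hj N).prodMk measurable_id)
  -- The selected maxima of the first N+1 functions increase to the supremum, so Fatou's lemma
  -- transfers the uniform bound.
  calc ∫⁻ x, ⨆ n, F n x ∂μ ≤ ∫⁻ x, liminf (fun N => F (j N x) x) atTop ∂μ := by
        refine lintegral_mono fun x => iSup_le fun n => ?_
        exact le_liminf_of_le (h := (eventually_ge_atTop n).mono fun N hnN => hjF N n hnN x)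
    _ ≤ liminf (fun N => ∫⁻ x, F (j N x) x ∂μ) atTop := lintegral_liminf_le hFj
    _ ≤ B := liminf_le_of_frequently_le' (Frequently.of_forall fun N => hB _ (hj N))

open scoped ComplexConjugate ENNReal in
/-- The maximal `TT*` bound for a sequence of operators whose cross kernels obey a Schur bound. -/
theorem lintegral_iSup_enorm_sq_le_of_kernel {X Y : Type*} [MeasurableSpace X] [MeasurableSpace Y]
    {μ : Measure X} {ν : Measure Y} [IsFiniteMeasure μ] [IsFiniteMeasure ν]
    {e : ℕ → X → Y → ℂ} (he : ∀ n, Measurable (Function.uncurry (e n)))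
    (he1 : ∀ n x y, ‖e n x y‖ ≤ 1)
    {h : Y → ℂ} (hh : MemLp h 2 ν) (hm : ∀ n, Measurable fun x => ∫ y, e n x y * h y ∂ν)
    {k : X → X → ℝ≥0∞} (hk : Measurable (Function.uncurry k))
    (hK : ∀ n m x x', ‖∫ y, e n x y * conj (e m x' y) ∂ν‖ₑ ≤ k x x') {b : ℝ} (hb : 0 < b)
    (hB : ∀ᵐ x ∂μ, ∫⁻ x', k x x' ∂μ ≤ ENNReal.ofReal b)
    (hB' : ∀ᵐ x' ∂μ, ∫⁻ x, k x x' ∂μ ≤ ENNReal.ofReal b) :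
    ∫⁻ x, ⨆ n, ‖∫ y, e n x y * h y ∂ν‖ₑ ^ 2 ∂μ ≤
      ENNReal.ofReal (2 * b) * ∫⁻ y, ‖h y‖ₑ ^ 2 ∂ν := by
  refine lintegral_iSup_le_of_measurable_selection (fun n => (hm n).enorm.pow_const 2)
    fun j hj => ?_
  have h1 : Measurable fun p : ℕ × (X × Y) => e p.1 p.2.1 p.2.2 :=
    measurable_from_prod_countable_right he
  have h2 : Measurable fun p : X × Y => (j p.1, p) :=
    (hj.comp measurable_fst).prodMk measurable_id
  have h3 : Measurable (Function.uncurry fun x y => e (j x) x y) := h1.comp h2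
  exact lintegral_enorm_sq_le_of_kernel (e := fun x y => e (j x) x y) h3
    (fun x y => he1 _ x y) hh hk (fun x x' => hK _ _ x x') hb hB hB'

/-! ### Truncated evolutions and their regularity -/

/-- The oscillating factor of the Schrödinger evolution. -/
noncomputable def oscillation (t y ξ : ℝ) : ℂ :=
  Complex.exp (Complex.I * ((y * (2 * Real.pi * ξ) + t * (2 * Real.pi * ξ) ^ 2 : ℝ) : ℂ))

/-- The truncated evolution of the frequency profile `h`. -/
noncomputable def truncatedEvolution (h : ℝ → ℂ) (R t y : ℝ) : ℂ :=
  ∫ ξ in (-R)..R, oscillation t y ξ * h ξ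

theorem norm_oscillation (t y ξ : ℝ) : ‖oscillation t y ξ‖ = 1 := by
  rw [oscillation, mul_comm]; exact Complex.norm_exp_ofReal_mul_I _

theorem continuous_oscillation :
    Continuous fun p : ℝ × ℝ × ℝ => oscillation p.1 p.2.1 p.2.2 := by
  unfold oscillation; fun_prop

open scoped ComplexConjugate in
theorem oscillation_mul_conj (t y t' y' ξ : ℝ) :
    oscillation t y ξ * conj (oscillation t' y' ξ) =
      Complex.exp (Complex.I * (((y - y') * (2 * Real.pi * ξ) +
        (t - t') * (2 * Real.pi * ξ) ^ 2 : ℝ) : ℂ)) := by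
  rw [oscillation, oscillation, ← Complex.exp_conj, ← Complex.exp_add, map_mul, Complex.conj_I,
    Complex.conj_ofReal]
  congr 1
  push_cast
  ring

/-- Puts all truncations on the common frequency space (-Λ, Λ]. The radius R then sits in the
bounded factor of the operator and can be selected along with t and θ. -/
theorem truncatedEvolution_eq_setIntegral {h : ℝ → ℂ} {R Λ : ℝ} (hR : R ∈ Icc 0 Λ) (t y : ℝ) :
    truncatedEvolution h R t y =
      ∫ ξ in Ioc (-Λ) Λ, (Ioc (-R) R).indicator (oscillation t y) ξ * h ξ := by
  have hsub : Ioc (-R) R ⊆ Ioc (-Λ) Λ := Ioc_subset_Ioc (neg_le_neg hR.2) hR.2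
  rw [truncatedEvolution, intervalIntegral.integral_of_le (by linarith [hR.1])]
  simp_rw [← indicator_mul_left]
  rw [setIntegral_indicator measurableSet_Ioc, inter_eq_right.2 hsub]

/-- Dominated convergence: the cutoff jumps only at ξ = ±R, a null set. Negative R are excluded
because there the interval integral reverses orientation while the indicator vanishes. -/
theorem continuousOn_truncatedEvolution {h : ℝ → ℂ} (hh : LocallyIntegrable h volume) :
    ContinuousOn (fun p : ℝ × ℝ × ℝ => truncatedEvolution h p.1 p.2.1 p.2.2)
      (Ici 0 ×ˢ (univ : Set (ℝ × ℝ))) := by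
  set F : ℝ × ℝ × ℝ → ℝ → ℂ := fun p ξ =>
    (Ioc (-p.1) p.1).indicator (fun ξ => oscillation p.2.1 p.2.2 ξ * h ξ) ξ with hF
  have hcont : Continuous fun p : ℝ × ℝ × ℝ => ∫ ξ, F p ξ := by
    rw [continuous_iff_continuousAt]
    intro p₀
    have hosc : ∀ p : ℝ × ℝ × ℝ, Continuous fun ξ => oscillation p.2.1 p.2.2 ξ := fun p =>
      continuous_oscillation.comp (by fun_prop : Continuous fun ξ : ℝ => (p.2.1, p.2.2, ξ))
    have hI : IntegrableOn h (Icc (-(p₀.1 + 1)) (p₀.1 + 1)) := hh.integrableOn_isCompact isCompact_Icc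
    refine continuousAt_of_dominated
      (bound := (Icc (-(p₀.1 + 1)) (p₀.1 + 1)).indicator fun ξ => ‖h ξ‖) ?_ ?_ ?_ ?_
    · exact Eventually.of_forall fun p =>
        ((hosc p).aestronglyMeasurable.mul hh.aestronglyMeasurable).indicator measurableSet_Ioc
    · have : ∀ᶠ p : ℝ × ℝ × ℝ in 𝓝 p₀, p.1 < p₀.1 + 1 :=
        continuous_fst.continuousAt.eventually_lt continuousAt_const (by simp)
      filter_upwards [this] with p hp
      refine Eventually.of_forall fun ξ => ?_
      rw [hF, norm_indicator_eq_indicator_norm]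
      have hsub : Ioc (-p.1) p.1 ⊆ Icc (-(p₀.1 + 1)) (p₀.1 + 1) := fun ξ hξ =>
        ⟨by linarith [hξ.1], by linarith [hξ.2]⟩
      simp_rw [norm_mul, norm_oscillation, one_mul]
      exact indicator_le_indicator_of_subset hsub (fun _ => norm_nonneg _) ξ
    · exact (integrable_indicator_iff measurableSet_Icc).2 hI.norm
    · have h1 : ∀ᵐ ξ : ℝ, ξ ≠ p₀.1 := by simp [ae_iff]
      have h2 : ∀ᵐ ξ : ℝ, ξ ≠ -p₀.1 := by simp [ae_iff]
      filter_upwards [h1, h2] with ξ hξ1 hξ2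
      have hc : ContinuousAt (fun p : ℝ × ℝ × ℝ => oscillation p.2.1 p.2.2 ξ * h ξ) p₀ :=
        ((continuous_oscillation.comp (by fun_prop :
          Continuous fun p : ℝ × ℝ × ℝ => (p.2.1, p.2.2, ξ))).mul continuous_const).continuousAt
      by_cases hin : -p₀.1 < ξ ∧ ξ < p₀.1
      · refine hc.congr ?_
        have e1 : ∀ᶠ p : ℝ × ℝ × ℝ in 𝓝 p₀, -p.1 < ξ :=
          continuous_fst.neg.continuousAt.eventually_lt continuousAt_const hin.1
        have e2 : ∀ᶠ p : ℝ × ℝ × ℝ in 𝓝 p₀, ξ < p.1 :=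
          continuousAt_const.eventually_lt continuous_fst.continuousAt hin.2
        filter_upwards [e1, e2] with p hp1 hp2
        exact (indicator_of_mem (s := Ioc (-p.1) p.1) ⟨hp1, hp2.le⟩
          fun ξ => oscillation p.2.1 p.2.2 ξ * h ξ).symm
      · refine (continuousAt_const (y := (0 : ℂ))).congr ?_
        rcases not_and_or.1 hin with hn | hn
        · have e1 : ∀ᶠ p : ℝ × ℝ × ℝ in 𝓝 p₀, ξ < -p.1 :=
            continuousAt_const.eventually_lt continuous_fst.neg.continuousAt
              (lt_of_le_of_ne (not_lt.1 hn) hξ2)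
          filter_upwards [e1] with p hp1
          exact (indicator_of_notMem (s := Ioc (-p.1) p.1) (fun hm => absurd hm.1 hp1.not_gt) _).symm
        · have e1 : ∀ᶠ p : ℝ × ℝ × ℝ in 𝓝 p₀, p.1 < ξ :=
            continuous_fst.continuousAt.eventually_lt continuousAt_const
              (lt_of_le_of_ne (not_lt.1 hn) hξ1.symm)
          filter_upwards [e1] with p hp1
          exact (indicator_of_notMem (s := Ioc (-p.1) p.1) (fun hm => absurd hm.2 hp1.not_ge) _).symm
  refine hcont.continuousOn.congr fun p hp => ?_
  have hp0 : 0 ≤ p.1 := hp.1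
  simp only [truncatedEvolution]
  rw [intervalIntegral.integral_of_le (by linarith), ← integral_indicator measurableSet_Ioc]

/-- Lets the supremum over (t, θ) be replaced by one over a countable dense set. -/
theorem IsTangentialFamily.continuousOn_time_param {γ : ℝ → ℝ → ℝ → ℝ} {Θ : Set ℝ} {α : ℝ}
    (hα : 0 < α) (hγ : IsTangentialFamily γ Θ α) (x : ℝ) :
    ContinuousOn (fun p : ℝ × ℝ => γ x p.1 p.2) (Icc 0 1 ×ˢ Θ) := by
  obtain ⟨C₂, hC₂, hH⟩ := hγ.holder
  obtain ⟨C₃, hC₃, hT⟩ := hγ.lipschitz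
  intro p₀ hp₀
  have hcont : Continuous fun p : ℝ × ℝ => C₂ * |p.1 - p₀.1| ^ α + C₃ * |p.2 - p₀.2| := by
    have : Continuous fun p : ℝ × ℝ => |p.1 - p₀.1| ^ α :=
      (by fun_prop : Continuous fun p : ℝ × ℝ => |p.1 - p₀.1|).rpow_const fun _ => Or.inr hα.le
    fun_prop
  have hlim : Tendsto (fun p : ℝ × ℝ => C₂ * |p.1 - p₀.1| ^ α + C₃ * |p.2 - p₀.2|)
      (𝓝[Icc 0 1 ×ˢ Θ] p₀) (𝓝 0) := by
    have := hcont.tendsto p₀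
    simp only [sub_self, abs_zero, Real.zero_rpow hα.ne', mul_zero, add_zero] at this
    exact this.mono_left nhdsWithin_le_nhds
  rw [ContinuousWithinAt, tendsto_iff_dist_tendsto_zero]
  refine squeeze_zero' (Eventually.of_forall fun _ => dist_nonneg) ?_ hlim
  filter_upwards [self_mem_nhdsWithin] with p hp
  rw [Real.dist_eq]
  have h1 := hH x p.2 hp.2 p.1 hp.1 p₀.1 hp₀.1
  have h2 := hT x p₀.1 hp₀.1 p.2 hp.2 p₀.2 hp₀.2
  calc |γ x p.1 p.2 - γ x p₀.1 p₀.2|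
      = |(γ x p.1 p.2 - γ x p₀.1 p.2) + (γ x p₀.1 p.2 - γ x p₀.1 p₀.2)| := by ring_nf
    _ ≤ _ := (abs_add_le _ _).trans (add_le_add h1 h2)

theorem lintegral_enorm_rpow_lt_top {ν : ℝ} (hν : ν < 1) :
    ∫⁻ z in Icc (-1 : ℝ) 1, ‖z‖ₑ ^ (-ν) < ⊤ := by
  have h1 : IntervalIntegrable (fun z : ℝ => |z| ^ (-ν)) volume 0 1 := by
    refine (intervalIntegral.intervalIntegrable_rpow' (by linarith : -1 < -ν)).congr ?_
    intro z hz
    rw [uIoc_of_le zero_le_one] at hz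
    simp only [abs_of_pos hz.1]
  have h2 : IntervalIntegrable (fun z : ℝ => |z| ^ (-ν)) volume (-1) 0 := by
    have := (IntervalIntegrable.iff_comp_neg (f := fun z : ℝ => |z| ^ (-ν))).1 h1
    simpa using this.symm
  have h3 := h2.trans h1
  rw [intervalIntegrable_iff_integrableOn_Icc_of_le (by norm_num)] at h3
  have h4 := h3.2
  rw [HasFiniteIntegral] at h4
  refine lt_of_eq_of_lt ?_ h4
  -- The origin is discarded: for ν > 0 the extended power is `⊤` there and the real one is 0.
  have h0 : ∀ᵐ z : ℝ ∂(volume.restrict (Icc (-1 : ℝ) 1)), z ≠ 0 :=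
    ae_restrict_of_ae (by simp [ae_iff])
  refine lintegral_congr_ae (h0.mono fun z hz => ?_)
  have hz' := abs_pos.2 hz
  simp only
  rw [Real.enorm_eq_ofReal (Real.rpow_nonneg hz'.le _), ← ofReal_norm, Real.norm_eq_abs,
    ENNReal.ofReal_rpow_of_pos hz']

theorem IsTangentialFamily.continuous_truncatedEvolution {γ : ℝ → ℝ → ℝ → ℝ} {Θ : Set ℝ} {α : ℝ}
    (hγ : IsTangentialFamily γ Θ α) {h : ℝ → ℂ} (hh : LocallyIntegrable h volume) {R t θ : ℝ}
    (hR : 0 ≤ R) (ht : t ∈ Icc (0 : ℝ) 1) (hθ : θ ∈ Θ) :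
    Continuous fun x => truncatedEvolution h R t (γ x t θ) := by
  have hg := (hγ.contDiff t ht θ hθ).continuous
  exact (continuousOn_truncatedEvolution hh).comp_continuous (f := fun x => (R, t, γ x t θ))
    (by fun_prop) fun x => ⟨hR, mem_univ _⟩

-- Two sharp symmetric cutoffs multiply to the smaller one, so the kernel is again a plain
-- oscillatory integral over a symmetric interval.
open scoped ComplexConjugate in
theorem setIntegral_indicator_oscillation_mul_conj {R R' Λ : ℝ} (hR : R ∈ Icc 0 Λ)
    (hR' : R' ∈ Icc 0 Λ) (t y t' y' : ℝ) :
    ∫ ξ in Ioc (-Λ) Λ, (Ioc (-R) R).indicator (oscillation t y) ξ *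
        conj ((Ioc (-R') R').indicator (oscillation t' y') ξ) =
      ∫ ξ in (-min R R')..(min R R'), Complex.exp (Complex.I *
        (((y - y') * (2 * Real.pi * ξ) + (t - t') * (2 * Real.pi * ξ) ^ 2 : ℝ) : ℂ)) := by
  have hρ : min R R' ∈ Icc 0 Λ := ⟨le_min hR.1 hR'.1, (min_le_left _ _).trans hR.2⟩
  simp_rw [← oscillation_mul_conj]
  rw [intervalIntegral.integral_of_le (by linarith [hρ.1])]
  have hpt : ∀ ξ, (Ioc (-R) R).indicator (oscillation t y) ξ *
        conj ((Ioc (-R') R').indicator (oscillation t' y') ξ) =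
      (Ioc (-min R R') (min R R')).indicator
        (fun ξ => oscillation t y ξ * conj (oscillation t' y' ξ)) ξ := by
    intro ξ
    have hI : Ioc (-min R R') (min R R') = Ioc (-R) R ∩ Ioc (-R') R' := by
      rw [Ioc_inter_Ioc, max_neg_neg]
    rw [hI, inter_indicator_mul]
    congr 1
    by_cases hξ : ξ ∈ Ioc (-R') R'
    · rw [indicator_of_mem hξ, indicator_of_mem hξ]
    · rw [indicator_of_notMem hξ, indicator_of_notMem hξ, map_zero]
  simp_rw [hpt]
  rw [setIntegral_indicator measurableSet_Ioc,
    inter_eq_right.2 (Ioc_subset_Ioc (neg_le_neg hρ.2) hρ.2)]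

/-! ### Maximal estimate for parameter sets of small diameter -/

/-- The truncated Riesz kernel, extended by `⊤` outside the unit interval. -/
noncomputable def rieszKernel (c : ENNReal) (ν z : ℝ) : ENNReal :=
  if |z| ≤ 1 then c * ‖z‖ₑ ^ (-ν) else ⊤

theorem measurable_rieszKernel (c : ENNReal) (ν : ℝ) : Measurable (rieszKernel c ν) :=
  Measurable.ite (measurableSet_le measurable_norm measurable_const)
    ((measurable_enorm.pow_const _).const_mul _) measurable_const

theorem rieszKernel_neg (c : ENNReal) (ν z : ℝ) : rieszKernel c ν (-z) = rieszKernel c ν z := by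
  simp [rieszKernel]

/-- Two points of a unit interval differ by at most 1, so the value `⊤`, which makes the kernel
bound vacuous at larger distances, is never met; the rest is translation invariance. -/
theorem setLIntegral_rieszKernel_le (c : ENNReal) (ν : ℝ) {n x : ℝ} (hx : x ∈ Icc n (n + 1)) :
    ∫⁻ x' in Icc n (n + 1), rieszKernel c ν (x - x') ≤
      c * ∫⁻ z in Icc (-1 : ℝ) 1, ‖z‖ₑ ^ (-ν) := by
  set w' : ℝ → ENNReal := (Icc (-1 : ℝ) 1).indicator fun z => c * ‖z‖ₑ ^ (-ν)
  calc ∫⁻ x' in Icc n (n + 1), rieszKernel c ν (x - x') ≤ ∫⁻ x' in Icc n (n + 1), w' (x - x') := by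
        refine setLIntegral_mono_ae' measurableSet_Icc (Eventually.of_forall fun x' hx' => ?_)
        have : |x - x'| ≤ 1 := abs_le.2 ⟨by linarith [hx.1, hx'.2], by linarith [hx.2, hx'.1]⟩
        simp only [rieszKernel, w', this, if_true]
        rw [indicator_of_mem (show x - x' ∈ Icc (-1 : ℝ) 1 from abs_le.1 this)]
    _ ≤ ∫⁻ x', w' (x - x') := setLIntegral_le_lintegral _ _
    _ = ∫⁻ z, w' z := lintegral_sub_left_eq_self w' x
    _ = c * ∫⁻ z in Icc (-1 : ℝ) 1, ‖z‖ₑ ^ (-ν) := by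
        rw [lintegral_indicator measurableSet_Icc,
          lintegral_const_mul _ (measurable_enorm.pow_const _)]

/-- The maximal estimate along a sequence of parameters confined to a set of diameter at most
`Λ^{-2α}`. -/
theorem exists_lintegral_iSup_truncatedEvolution_le {γ : ℝ → ℝ → ℝ → ℝ} {Θ : Set ℝ} {α ν : ℝ}
    (hα : 0 < α) (hα' : α ≤ 1 / 4) (hγ : IsTangentialFamily γ Θ α) (hν : 1 / 2 ≤ ν) (hν' : ν < 1) :
    ∃ C : ℝ, 0 < C ∧ ∀ Λ : ℝ, 1 ≤ Λ → ∀ R t θ : ℕ → ℝ, (∀ m, R m ∈ Icc 0 Λ) →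
      (∀ m, t m ∈ Icc (0 : ℝ) 1) → (∀ m, θ m ∈ Θ) →
      (∀ m m', |θ m - θ m'| ≤ Λ ^ (-(2 * α))) → ∀ n : ℝ, ∀ h : ℝ → ℂ, MemLp h 2 volume →
      ∫⁻ x in Icc n (n + 1), ⨆ m, ‖truncatedEvolution h (R m) (t m) (γ x (t m) (θ m))‖ₑ ^ 2 ≤
          ENNReal.ofReal (C * Λ ^ (1 - 2 * α * ν)) * ∫⁻ ξ, ‖h ξ‖ₑ ^ 2 := by
  obtain ⟨D, hD, hker⟩ := exists_norm_kernel_le hα hα' hγ hν hν'.le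
  set E : ℝ := (∫⁻ z in Icc (-1 : ℝ) 1, ‖z‖ₑ ^ (-ν)).toReal with hE
  have hE0 : 0 ≤ E := ENNReal.toReal_nonneg
  have hEE : ∫⁻ z in Icc (-1 : ℝ) 1, ‖z‖ₑ ^ (-ν) ≤ ENNReal.ofReal (E + 1) := by
    rw [← ENNReal.ofReal_toReal (lintegral_enorm_rpow_lt_top hν').ne]
    exact ENNReal.ofReal_le_ofReal (by linarith)
  refine ⟨2 * (D * (E + 1)), by positivity, ?_⟩
  intro Λ hΛ R t θ hR ht hθ hdiam n h hh
  have hΛ0 : 0 < Λ := by linarith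
  have hloc : LocallyIntegrable h volume := hh.locallyIntegrable (by norm_num)
  have hc0 : 0 < D * Λ ^ (1 - 2 * α * ν) := by positivity
  have hb : 0 < D * (E + 1) * Λ ^ (1 - 2 * α * ν) := by positivity
  set w : ℝ → ENNReal := rieszKernel (ENNReal.ofReal (D * Λ ^ (1 - 2 * α * ν))) ν with hw
  have hw1 : ∀ x ∈ Icc n (n + 1), ∫⁻ x' in Icc n (n + 1), w (x - x') ≤
      ENNReal.ofReal (D * (E + 1) * Λ ^ (1 - 2 * α * ν)) := by
    intro x hx
    refine (setLIntegral_rieszKernel_le _ ν hx).trans ((mul_le_mul_right hEE _).trans ?_)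
    rw [← ENNReal.ofReal_mul hc0.le]
    exact ENNReal.ofReal_le_ofReal (by nlinarith)
  have hw2 : ∀ x' ∈ Icc n (n + 1), ∫⁻ x in Icc n (n + 1), w (x - x') ≤
      ENNReal.ofReal (D * (E + 1) * Λ ^ (1 - 2 * α * ν)) := by
    intro x' hx'
    refine le_trans (le_of_eq ?_) (hw1 x' hx')
    congr 1; ext x
    rw [← neg_sub, hw, rieszKernel_neg]
  set e : ℕ → ℝ → ℝ → ℂ := fun m x ξ =>
      (Ioc (-R m) (R m)).indicator (oscillation (t m) (γ x (t m) (θ m))) ξ with he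
  have hte : ∀ m x, truncatedEvolution h (R m) (t m) (γ x (t m) (θ m)) =
      ∫ ξ in Ioc (-Λ) Λ, e m x ξ * h ξ := fun m x =>
    truncatedEvolution_eq_setIntegral (hR m) _ _
  have hem : ∀ m, Measurable (Function.uncurry (e m)) := fun m => by
    have hg := (hγ.contDiff (t m) (ht m) (θ m) (hθ m)).continuous
    have ho : Continuous fun p : ℝ × ℝ => oscillation (t m) (γ p.1 (t m) (θ m)) p.2 :=
      continuous_oscillation.comp (by fun_prop :
        Continuous fun p : ℝ × ℝ => (t m, γ p.1 (t m) (θ m), p.2))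
    exact ho.measurable.indicator (measurable_snd measurableSet_Ioc)
  have hK : ∀ m m' x x', ‖∫ ξ in Ioc (-Λ) Λ, e m x ξ * (starRingEnd ℂ) (e m' x' ξ)‖ₑ ≤
      w (x - x') := by
    intro m m' x x'
    rw [hw, rieszKernel]
    split_ifs with hxx
    swap
    · exact le_top
    -- On the diagonal the Riesz kernel is `⊤` and nothing has to be proved.
    rcases eq_or_ne x x' with rfl | hne
    · rw [sub_self, enorm_zero, ENNReal.zero_rpow_of_neg (by linarith),
        ENNReal.mul_top (ENNReal.ofReal_pos.2 hc0).ne']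
      exact le_top
    have hp := abs_pos.2 (sub_ne_zero.2 hne)
    rw [setIntegral_indicator_oscillation_mul_conj (hR m) (hR m'), ← ofReal_norm,
      ← ofReal_norm (x - x'), Real.norm_eq_abs (x - x'),
      ENNReal.ofReal_rpow_of_pos hp, ← ENNReal.ofReal_mul hc0.le, mul_assoc]
    exact ENNReal.ofReal_le_ofReal (hker Λ hΛ _
      ⟨le_min (hR m).1 (hR m').1, (min_le_left _ _).trans (hR m).2⟩ x x' hne hxx _ (ht m) _ (ht m')
      _ (hθ m) _ (hθ m') (hdiam m m'))
  have hmain := lintegral_iSup_enorm_sq_le_of_kernel (μ := volume.restrict (Icc n (n + 1)))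
    (ν := volume.restrict (Ioc (-Λ) Λ)) (e := e) (h := h) (k := fun x x' => w (x - x')) hem
    (fun m x ξ => (norm_indicator_le_norm_self _ _).trans (norm_oscillation _ _ _).le) (hh.restrict _)
    (fun m => by
      simp_rw [← hte]
      exact (hγ.continuous_truncatedEvolution hloc (hR m).1 (ht m) (hθ m)).measurable)
    ((measurable_rieszKernel _ ν).comp (measurable_fst.sub measurable_snd)) hK hb
    ((ae_restrict_iff' measurableSet_Icc).2 (Eventually.of_forall hw1))
    ((ae_restrict_iff' measurableSet_Icc).2 (Eventually.of_forall hw2))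
  simp_rw [hte]
  refine hmain.trans ?_
  gcongr ?_ * ?_
  · exact ENNReal.ofReal_le_ofReal (le_of_eq (by ring))
  · exact setLIntegral_le_lintegral _ _

/-- The maximal estimate over a piece of the parameter set of diameter at most `Λ^{-2α}`. -/
theorem exists_maximal_of_diam_le {γ : ℝ → ℝ → ℝ → ℝ} {Θ : Set ℝ} {α ν : ℝ} (hα : 0 < α)
    (hα' : α ≤ 1 / 4) (hγ : IsTangentialFamily γ Θ α) (hν : 1 / 2 ≤ ν) (hν' : ν < 1) :
    ∃ C : ℝ, 0 < C ∧ ∀ Λ : ℝ, 1 ≤ Λ → ∀ Θ' ⊆ Θ,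
      (∀ θ ∈ Θ', ∀ θ' ∈ Θ', |θ - θ'| ≤ Λ ^ (-(2 * α))) → ∀ n : ℝ, ∀ h : ℝ → ℂ, MemLp h 2 volume →
      ∃ M : ℝ → ENNReal, Measurable M ∧
        (∀ x, ∀ R ∈ Icc 0 Λ, ∀ t ∈ Icc (0 : ℝ) 1, ∀ θ ∈ Θ',
          ‖truncatedEvolution h R t (γ x t θ)‖ₑ ^ 2 ≤ M x) ∧
        ∫⁻ x in Icc n (n + 1), M x ≤
          ENNReal.ofReal (C * Λ ^ (1 - 2 * α * ν)) * ∫⁻ ξ, ‖h ξ‖ₑ ^ 2 := by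
  obtain ⟨C, hC, hbound⟩ := exists_lintegral_iSup_truncatedEvolution_le hα hα' hγ hν hν'
  refine ⟨C, hC, ?_⟩
  intro Λ hΛ Θ' hΘ' hdiam n h hh
  have hΛ0 : 0 < Λ := by linarith
  rcases Θ'.eq_empty_or_nonempty with rfl | ⟨θ₀, hθ₀⟩
  · exact ⟨fun _ => 0, measurable_const, by simp, by simp⟩
  let S : Set (ℝ × ℝ × ℝ) := Icc 0 Λ ×ˢ (Icc 0 1 ×ˢ Θ')
  have : Nonempty S := ⟨⟨(0, 0, θ₀), ⟨le_rfl, hΛ0.le⟩, ⟨le_rfl, zero_le_one⟩, hθ₀⟩⟩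
  -- The supremum along a dense sequence of triples (R, t, θ) is measurable in x, and continuity
  -- extends the pointwise bound to all triples.
  obtain ⟨d, hd⟩ := TopologicalSpace.exists_dense_seq S
  have hloc : LocallyIntegrable h volume := hh.locallyIntegrable (by norm_num)
  have hcp : ∀ x, Continuous fun p : S =>
      truncatedEvolution h p.1.1 p.1.2.1 (γ x p.1.2.1 p.1.2.2) := fun x => by
    have hg : Continuous fun p : S => γ x p.1.2.1 p.1.2.2 :=
      (hγ.continuousOn_time_param hα x).comp_continuous (f := fun p : S => p.1.2) (by fun_prop)
        fun p => ⟨p.2.2.1, hΘ' p.2.2.2⟩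
    have hg' : Continuous fun p : S => (p.1.1, p.1.2.1, γ x p.1.2.1 p.1.2.2) :=
      (continuous_fst.comp continuous_subtype_val).prodMk
        ((continuous_fst.comp (continuous_snd.comp continuous_subtype_val)).prodMk hg)
    exact (continuousOn_truncatedEvolution hloc).comp_continuous hg' fun p => ⟨p.2.1.1, mem_univ _⟩
  refine ⟨fun x => ⨆ m,
    ‖truncatedEvolution h (d m).1.1 (d m).1.2.1 (γ x (d m).1.2.1 (d m).1.2.2)‖ₑ ^ 2,
    Measurable.iSup fun m => (hγ.continuous_truncatedEvolution hloc (d m).2.1.1 (d m).2.2.1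
      (hΘ' (d m).2.2.2)).measurable.enorm.pow_const 2, ?_, ?_⟩
  · intro x R hR t ht θ hθ
    refine hd.induction_on (p := fun p : S =>
      ‖truncatedEvolution h p.1.1 p.1.2.1 (γ x p.1.2.1 p.1.2.2)‖ₑ ^ 2 ≤ _)
      (⟨(R, t, θ), hR, ht, hθ⟩ : S) ?_ ?_
    · exact isClosed_le ((ENNReal.continuous_pow 2).comp (hcp x).enorm) continuous_const
    · intro m
      exact le_iSup (fun m =>
        ‖truncatedEvolution h (d m).1.1 (d m).1.2.1 (γ x (d m).1.2.1 (d m).1.2.2)‖ₑ ^ 2) m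
  · exact hbound Λ hΛ (fun m => (d m).1.1) (fun m => (d m).1.2.1) (fun m => (d m).1.2.2)
      (fun m => (d m).2.1) (fun m => (d m).2.2.1) (fun m => hΘ' (d m).2.2.2)
      (fun m m' => hdiam _ (d m).2.2.2 _ (d m').2.2.2) n h hh

/-! ### Sobolev weights and recovery of f at time zero -/

/-- The Fourier transform of an `H^s` function, `s ≥ 0`, is `(1 + ξ²)^{-s/2}` times an `L²`
function. -/
theorem MemHs.exists_fourier_eq {s : ℝ} (hs : 0 ≤ s) {f : Lp ℂ 2 (volume : Measure ℝ)}
    (hf : MemHs s f) :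
    ∃ u : Lp ℂ 2 (volume : Measure ℝ), ∀ᵐ ξ : ℝ,
      (𝓕 f : Lp ℂ 2 (volume : Measure ℝ)) ξ = (((1 + ‖ξ‖ ^ 2) ^ (-s / 2) : ℝ) : ℂ) * u ξ := by
  obtain ⟨u, hu⟩ := TemperedDistribution.memSobolev_iff_exists_smulLeftCLM_fourier.1 hf
  rw [Lp.fourier_toTemperedDistribution_eq] at hu
  set g : ℝ → ℂ := fun ξ => (((1 + ‖ξ‖ ^ 2) ^ (-s / 2) : ℝ) : ℂ) with hg
  have hgt : g.HasTemperateGrowth := by rw [hg]; fun_prop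
  -- Since s ≥ 0 the weight is bounded, so its product with u stays in L²; injectivity of L² into
  -- tempered distributions then identifies this product with the transform of f.
  have hgm : MemLp g ⊤ volume := by
    refine memLp_top_of_bound hgt.1.continuous.aestronglyMeasurable 1 (Eventually.of_forall ?_)
    intro ξ
    rw [hg, Complex.norm_real, Real.norm_of_nonneg (by positivity)]
    exact Real.rpow_le_one_of_one_le_of_nonpos (by nlinarith [sq_nonneg ‖ξ‖]) (by linarith)
  have hgt' : (fun ξ : ℝ => (((1 + ‖ξ‖ ^ 2) ^ (s / 2) : ℝ) : ℂ)).HasTemperateGrowth := by fun_prop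
  have hkey : Lp.toTemperedDistribution (hgm.toLp _ • u : Lp ℂ 2 (volume : Measure ℝ)) =
      Lp.toTemperedDistribution (𝓕 f : Lp ℂ 2 (volume : Measure ℝ)) := by
    rw [MeasureTheory.Lp.toTemperedDistribution_smul_eq hgt, ← hu,
      TemperedDistribution.smulLeftCLM_smulLeftCLM_apply hgt' hgt]
    have hone : (fun ξ : ℝ => (((1 + ‖ξ‖ ^ 2) ^ (s / 2) : ℝ) : ℂ)) * g = fun _ => 1 := by
      ext ξ
      have h0 : 0 < 1 + ‖ξ‖ ^ 2 := by positivity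
      simp only [Pi.mul_apply, hg]
      rw [← Complex.ofReal_mul, ← Real.rpow_add h0]
      ring_nf
      simp
    rw [hone, TemperedDistribution.smulLeftCLM_const, one_smul]
  have hinj : Function.Injective (Lp.toTemperedDistributionCLM ℂ (volume : Measure ℝ) 2) :=
    LinearMap.ker_eq_bot.1 Lp.ker_toTemperedDistributionCLM_eq_bot
  refine ⟨u, ?_⟩
  rw [← hinj hkey]
  filter_upwards [Lp.coeFn_lpSMul (r := 2) (hgm.toLp _) u, hgm.coeFn_toLp] with ξ h1 h2
  rw [h1, Pi.smul_apply', h2, smul_eq_mul]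

/-- Gives the inverse transform the continuity and exchange formulas for Fourier integrals attached
to a bilinear form; the sign is moved into the form. -/
theorem fourierInv_eq_vectorFourierIntegral (f : ℝ → ℂ) :
    𝓕⁻ f = VectorFourier.fourierIntegral Real.fourierChar volume (-innerₗ ℝ) f := by
  ext x
  rw [Real.fourierInv_eq, VectorFourier.fourierIntegral]
  simp

/-- The `L²` inverse Fourier transform of an integrable function is given by the integral. -/
theorem Lp.coeFn_fourierInv_eq_of_integrable (g : Lp ℂ 2 (volume : Measure ℝ))
    (hg : Integrable g volume) :
    ∀ᵐ x : ℝ, (𝓕⁻ g : Lp ℂ 2 (volume : Measure ℝ)) x = 𝓕⁻ (g : ℝ → ℂ) x := by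
  have hcont : Continuous (𝓕⁻ (g : ℝ → ℂ)) := by
    rw [fourierInv_eq_vectorFourierIntegral]
    exact VectorFourier.fourierIntegral_continuous Real.continuous_fourierChar
      (by simp only [LinearMap.neg_apply]; exact continuous_inner.neg) hg
  -- Both sides are locally integrable, so it suffices to test against smooth compactly supported
  -- functions, where each side moves the transform onto the test function.
  refine ae_eq_of_integral_contDiff_smul_eq ((Lp.memLp _).locallyIntegrable (by norm_num))
    hcont.locallyIntegrable fun φ hφ hφc => ?_
  have hφ₁ : HasCompactSupport (Complex.ofRealCLM ∘ φ) := hφc.comp_left rfl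
  have hφ₂ : ContDiff ℝ (⊤ : ℕ∞) (Complex.ofRealCLM ∘ φ) := by fun_prop
  set Φ : SchwartzMap ℝ ℂ := hφ₁.toSchwartzMap hφ₂ with hΦ
  have hΦx : ∀ x, Φ x = (φ x : ℂ) := fun x => rfl
  calc ∫ x, φ x • (𝓕⁻ g : Lp ℂ 2 (volume : Measure ℝ)) x
      = Lp.toTemperedDistribution (𝓕⁻ g : Lp ℂ 2 (volume : Measure ℝ)) Φ := by
        rw [Lp.toTemperedDistribution_apply]
        simp [hΦx]
    _ = Lp.toTemperedDistribution g (𝓕⁻ Φ) := by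
        rw [← Lp.fourierInv_toTemperedDistribution_eq]; rfl
    _ = ∫ ξ, 𝓕⁻ (Φ : ℝ → ℂ) ξ • g ξ := by
        rw [Lp.toTemperedDistribution_apply, SchwartzMap.fourierInv_coe]
    _ = ∫ x, Φ x • 𝓕⁻ (g : ℝ → ℂ) x := by
        rw [fourierInv_eq_vectorFourierIntegral, fourierInv_eq_vectorFourierIntegral]
        have hflip : (-innerₗ ℝ : ℝ →ₗ[ℝ] ℝ →ₗ[ℝ] ℝ).flip = -innerₗ ℝ := by
          ext; simp
        have := VectorFourier.integral_fourierIntegral_smul_eq_flip (L := -innerₗ ℝ)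
          (μ := volume) (ν := volume) Real.continuous_fourierChar
          (by simp only [LinearMap.neg_apply]; exact continuous_inner.neg) Φ.integrable hg
        rwa [hflip] at this
    _ = ∫ x, φ x • 𝓕⁻ (g : ℝ → ℂ) x := by simp [hΦx]

theorem truncatedEvolution_zero_eq_fourierInv (h : ℝ → ℂ) {R : ℝ} (hR : 0 ≤ R) (x : ℝ) :
    truncatedEvolution h R 0 x = 𝓕⁻ ((Ioc (-R) R).indicator h) x := by
  rw [Real.fourierInv_eq', truncatedEvolution, intervalIntegral.integral_of_le (by linarith),
    ← integral_indicator measurableSet_Ioc]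
  congr 1; ext ξ
  by_cases hξ : ξ ∈ Ioc (-R) R
  · rw [indicator_of_mem hξ, indicator_of_mem hξ, oscillation, smul_eq_mul]
    congr 2
    simp
    ring
  · rw [indicator_of_notMem hξ, indicator_of_notMem hξ, smul_zero]

/-- Symmetric truncations of the Fourier integral of an `L²` function converge to it almost
everywhere along some sequence of radii. -/
theorem exists_seq_tendsto_truncatedEvolution_zero (f : Lp ℂ 2 (volume : Measure ℝ)) :
    ∃ N : ℕ → ℕ, StrictMono N ∧ ∀ᵐ x : ℝ, Tendsto
      (fun k => truncatedEvolution (𝓕 f : Lp ℂ 2 (volume : Measure ℝ)) (N k) 0 x)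
      atTop (𝓝 (f x)) := by
  set g : Lp ℂ 2 (volume : Measure ℝ) := 𝓕 f with hg
  have hm : ∀ n : ℕ, MemLp ((Ioc (-(n : ℝ)) n).indicator g) 2 volume := fun n =>
    (Lp.memLp g).indicator measurableSet_Ioc
  set G : ℕ → Lp ℂ 2 (volume : Measure ℝ) := fun n => (hm n).toLp _ with hG
  have hlim : Tendsto G atTop (𝓝 g) := by
    rw [Lp.tendsto_Lp_iff_tendsto_eLpNorm']
    have hint : ∀ n, eLpNorm ((G n : ℝ → ℂ) - (g : ℝ → ℂ)) 2 volume =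
        (∫⁻ ξ, ((Ioc (-(n : ℝ)) n)ᶜ.indicator (fun ξ => ‖g ξ‖ₑ ^ (2 : ℝ)) ξ)) ^ (1 / 2 : ℝ) := by
      intro n
      rw [eLpNorm_eq_lintegral_rpow_enorm_toReal (by norm_num) (by norm_num)]
      congr 1
      refine lintegral_congr_ae ((hm n).coeFn_toLp.mono fun ξ hξ => ?_)
      simp only [hG, Pi.sub_apply, hξ, ENNReal.toReal_ofNat]
      by_cases h : ξ ∈ Ioc (-(n : ℝ)) n
      · rw [indicator_of_mem h, indicator_of_notMem (by simpa using h)]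
        simp
      · rw [indicator_of_notMem h, indicator_of_mem h, zero_sub, enorm_neg]
    simp_rw [hint]
    have h0 : (0 : ENNReal) = (∫⁻ _ : ℝ, (0 : ENNReal)) ^ (1 / 2 : ℝ) := by simp
    rw [h0]
    refine (ENNReal.continuous_rpow_const.tendsto _).comp ?_
    refine tendsto_lintegral_of_dominated_convergence' (fun ξ => ‖g ξ‖ₑ ^ (2 : ℝ)) ?_ ?_ ?_ ?_
    · intro n
      exact ((Lp.aestronglyMeasurable g).enorm.pow_const _).indicator measurableSet_Ioc.compl
    · exact fun n => Eventually.of_forall fun ξ => indicator_le_self' (fun _ _ => bot_le) ξ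
    · have := lintegral_rpow_enorm_lt_top_of_eLpNorm_lt_top (p := 2) (by norm_num) (by norm_num)
        (Lp.memLp g).2
      simpa using this.ne
    · refine Eventually.of_forall fun ξ => tendsto_const_nhds.congr' ?_
      obtain ⟨n, hn⟩ := exists_nat_gt |ξ|
      filter_upwards [eventually_ge_atTop n] with k hk
      have hk' : (n : ℝ) ≤ k := by exact_mod_cast hk
      have := abs_lt.1 (hn.trans_le hk')
      rw [indicator_of_notMem]
      exact fun h => h ⟨this.1, this.2.le⟩
  -- The inverse Plancherel isometry gives L² convergence to f, hence almost everywhere convergence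
  -- along a subsequence.
  have hlim' : Tendsto (fun n => (𝓕⁻ (G n) : Lp ℂ 2 (volume : Measure ℝ))) atTop (𝓝 f) := by
    have := ((Lp.fourierTransformₗᵢ ℝ ℂ).symm.continuous.tendsto g).comp hlim
    have hf : (Lp.fourierTransformₗᵢ ℝ ℂ).symm g = f := LinearIsometryEquiv.symm_apply_apply _ f
    rw [hf] at this
    exact this
  obtain ⟨N, hN, hae⟩ := (tendstoInMeasure_of_tendsto_Lp hlim').exists_seq_tendsto_ae
  refine ⟨N, hN, ?_⟩
  have hid : ∀ n : ℕ, ∀ᵐ x : ℝ, (𝓕⁻ (G n) : Lp ℂ 2 (volume : Measure ℝ)) x =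
      truncatedEvolution g n 0 x := by
    intro n
    have hint : Integrable ((Ioc (-(n : ℝ)) n).indicator g) volume := by
      rw [integrable_indicator_iff measurableSet_Ioc]
      exact (((Lp.memLp g).locallyIntegrable (by norm_num)).integrableOn_isCompact
        isCompact_Icc).mono_set Ioc_subset_Icc_self
    filter_upwards [Lp.coeFn_fourierInv_eq_of_integrable (G n)
      (hint.congr (hm n).coeFn_toLp.symm)] with x hx
    rw [hx, truncatedEvolution_zero_eq_fourierInv _ n.cast_nonneg, Real.fourierInv_eq,
      Real.fourierInv_eq]
    exact integral_congr_ae ((hm n).coeFn_toLp.mono fun ξ hξ => by simp only [hG, hξ])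
  filter_upwards [hae, ae_all_iff.2 hid] with x hx1 hx2
  simpa only [hx2] using hx1

/-! ### Covering numbers and logarithmic density -/

/-- Compactness makes the extended covering number finite, so `toNat` does not fall back to 0, and
the infimum over covers is attained. -/
theorem exists_finset_card_eq_ballCoveringNumber {Θ : Set ℝ} (hΘ : IsCompact Θ) {δ : ℝ}
    (hδ : 0 < δ) :
    ∃ T : Finset ℝ, T.card = ballCoveringNumber Θ δ ∧ ∀ θ ∈ Θ, ∃ y ∈ T, |θ - y| ≤ δ / 2 := by
  have hδ' : (δ / 2).toNNReal ≠ 0 := by simpa using hδ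
  obtain ⟨C', -, hC'fin, hC'⟩ := Metric.exists_finite_isCover_of_isCompact hδ' hΘ
  have : Nonempty {s : Set ℝ // Metric.IsCover (δ / 2).toNNReal Θ s} := ⟨C', hC'⟩
  obtain ⟨⟨C, hC⟩, hCe⟩ := ENat.exists_eq_iInf
    (fun C : {s : Set ℝ // Metric.IsCover (δ / 2).toNNReal Θ s} => (C : Set ℝ).encard)
  rw [iInf_subtype] at hCe
  have hCe' : C.encard = Metric.externalCoveringNumber (δ / 2).toNNReal Θ := hCe
  have hfin : C.Finite := by
    rw [← Set.encard_lt_top_iff, hCe']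
    exact (hC'.externalCoveringNumber_le_encard).trans_lt (Set.encard_lt_top_iff.2 hC'fin)
  refine ⟨hfin.toFinset, ?_, fun θ hθ => ?_⟩
  · rw [ballCoveringNumber, ← hCe', hfin.encard_eq_coe_toFinset_card, ENat.toNat_natCast]
  · have := Metric.isCover_iff_subset_iUnion_closedBall.1 hC hθ
    simp only [mem_iUnion, Metric.mem_closedBall, Real.dist_eq] at this
    obtain ⟨y, hy, hd⟩ := this
    rw [Real.coe_toNNReal _ (by positivity)] at hd
    exact ⟨y, by simpa using hy, hd⟩

theorem ballCoveringNumber_le_card {Θ : Set ℝ} {δ : ℝ} (hδ : 0 < δ) {T : Finset ℝ}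
    (hT : ∀ θ ∈ Θ, ∃ y ∈ T, |θ - y| ≤ δ / 2) : ballCoveringNumber Θ δ ≤ T.card := by
  have hc : Metric.IsCover (δ / 2).toNNReal Θ (T : Set ℝ) := by
    rw [Metric.isCover_iff_subset_iUnion_closedBall]
    intro θ hθ
    obtain ⟨y, hy, hd⟩ := hT θ hθ
    simp only [mem_iUnion, Metric.mem_closedBall, Real.dist_eq]
    exact ⟨y, hy, by rwa [Real.coe_toNNReal _ (by positivity)]⟩
  have h1 := hc.externalCoveringNumber_le_encard
  rw [Set.encard_coe_eq_coe_finsetCard] at h1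
  rw [ballCoveringNumber]
  exact ENat.toNat_le_of_le_natCast h1

theorem exists_ballCoveringNumber_le_div {Θ : Set ℝ} (hΘ : IsCompact Θ) :
    ∃ C : ℝ, 1 ≤ C ∧ ∀ δ ∈ Ioc (0 : ℝ) 1, (ballCoveringNumber Θ δ : ℝ) ≤ C / δ := by
  obtain ⟨A, hA⟩ := hΘ.isBounded.exists_norm_le
  set A' := max A 0 with hA'
  have hA0 : 0 ≤ A' := le_max_right _ _
  refine ⟨4 * A' + 1, by linarith, fun δ hδ => ?_⟩
  have hδ2 : 0 < δ / 2 := by linarith [hδ.1]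
  set m := ⌊2 * A' / (δ / 2)⌋₊ with hm
  have hcard : ((Finset.range (m + 1)).image fun j : ℕ => -A' + j * (δ / 2)).card ≤ m + 1 :=
    Finset.card_image_le.trans (by simp)
  have hcov : ballCoveringNumber Θ δ ≤ m + 1 := by
    refine (ballCoveringNumber_le_card hδ.1 fun θ hθ => ?_).trans hcard
    have hθ1 : |θ| ≤ A' := (hA θ hθ).trans (le_max_left _ _)
    have hθ2 := abs_le.1 hθ1
    have h0 : 0 ≤ (θ + A') / (δ / 2) := div_nonneg (by linarith) hδ2.le
    refine ⟨_, Finset.mem_image_of_mem _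
      (Finset.mem_range.2 (Nat.lt_succ_of_le (Nat.floor_le_floor
        (show (θ + A') / (δ / 2) ≤ 2 * A' / (δ / 2) by gcongr; linarith)))), ?_⟩
    have h1 := Nat.floor_le h0
    have h2 := Nat.lt_floor_add_one ((θ + A') / (δ / 2))
    rw [le_div_iff₀ hδ2] at h1
    rw [div_lt_iff₀ hδ2] at h2
    rw [abs_le]
    constructor <;> nlinarith
  have hm' : (m : ℝ) ≤ 2 * A' / (δ / 2) := Nat.floor_le (by positivity)
  calc (ballCoveringNumber Θ δ : ℝ) ≤ m + 1 := by exact_mod_cast hcov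
    _ ≤ 2 * A' / (δ / 2) + 1 / δ := by
        gcongr
        rw [le_div_iff₀ hδ.1]; linarith [hδ.2]
    _ = (4 * A' + 1) / δ := by field_simp; ring

/-- A real-valued `limsup` is meaningful only for bounded functions. From N(δ) ≤ C/δ the quotient is
at most 2 once δ < 1/C. -/
theorem isBoundedUnder_log_ballCoveringNumber {Θ : Set ℝ} (hΘ : IsCompact Θ) :
    IsBoundedUnder (· ≤ ·) (𝓝[>] (0 : ℝ))
      (fun δ : ℝ => Real.log (ballCoveringNumber Θ δ : ℝ) / (-Real.log δ)) := by
  obtain ⟨C, hC, hN⟩ := exists_ballCoveringNumber_le_div hΘ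
  have hC0 : 0 < C := by linarith
  refine ⟨2, eventually_map.2 ?_⟩
  have h1 : ∀ᶠ δ in 𝓝[>] (0 : ℝ), δ ∈ Ioo (0 : ℝ) (min C⁻¹ 1) :=
    Ioo_mem_nhdsGT (lt_min (by positivity) one_pos)
  filter_upwards [h1] with δ hδ
  have hδC : δ < C⁻¹ := hδ.2.trans_le (min_le_left _ _)
  have hδ1 : δ < 1 := hδ.2.trans_le (min_le_right _ _)
  have hlog : 0 < -Real.log δ := neg_pos.2 (Real.log_neg hδ.1 hδ1)
  rw [div_le_iff₀ hlog]
  rcases (ballCoveringNumber Θ δ).eq_zero_or_pos with h0 | h0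
  · rw [h0]; simp only [Nat.cast_zero, Real.log_zero]; linarith
  · have h0' : (0 : ℝ) < ballCoveringNumber Θ δ := by exact_mod_cast h0
    have h2 := Real.log_le_log h0' (hN δ ⟨hδ.1, hδ1.le⟩)
    rw [Real.log_div hC0.ne' hδ.1.ne'] at h2
    have h3 := Real.log_lt_log hδ.1 hδC
    rw [Real.log_inv] at h3
    linarith

theorem eventually_ballCoveringNumber_le_rpow {Θ : Set ℝ} (hΘ : IsCompact Θ) {b : ℝ}
    (hb : logDensity Θ < b) :
    ∀ᶠ δ in 𝓝[>] (0 : ℝ), (ballCoveringNumber Θ δ : ℝ) ≤ δ ^ (-b) := by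
  have h1 := eventually_lt_of_limsup_lt hb (isBoundedUnder_log_ballCoveringNumber hΘ)
  have h2 : ∀ᶠ δ in 𝓝[>] (0 : ℝ), δ ∈ Ioo (0 : ℝ) 1 := Ioo_mem_nhdsGT one_pos
  filter_upwards [h1, h2] with δ hδ hδ'
  have hlog : 0 < -Real.log δ := neg_pos.2 (Real.log_neg hδ'.1 hδ'.2)
  rw [div_lt_iff₀ hlog] at hδ
  rcases (ballCoveringNumber Θ δ).eq_zero_or_pos with h0 | h0
  · rw [h0, Nat.cast_zero]; exact Real.rpow_nonneg hδ'.1.le _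
  · have h0' : (0 : ℝ) < ballCoveringNumber Θ δ := by exact_mod_cast h0
    rw [← Real.log_le_log_iff h0' (Real.rpow_pos_of_pos hδ'.1 _), Real.log_rpow hδ'.1]
    linarith

theorem logDensity_nonneg {Θ : Set ℝ} (hΘ : IsCompact Θ) : 0 ≤ logDensity Θ := by
  refine le_limsup_of_frequently_le (Eventually.frequently ?_)
    (isBoundedUnder_log_ballCoveringNumber hΘ)
  have h2 : ∀ᶠ δ in 𝓝[>] (0 : ℝ), δ ∈ Ioo (0 : ℝ) 1 := Ioo_mem_nhdsGT one_pos
  filter_upwards [h2] with δ hδ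
  exact div_nonneg (Real.log_natCast_nonneg _) (neg_pos.2 (Real.log_neg hδ.1 hδ.2)).le

/-! ### Maximal estimate over the full parameter set -/

/-- The maximal estimate over the whole parameter set. -/
theorem exists_maximal {γ : ℝ → ℝ → ℝ → ℝ} {Θ : Set ℝ} (hΘ : IsCompact Θ) {α q : ℝ} (hα : 0 < α)
    (hα' : α ≤ 1 / 4) (hγ : IsTangentialFamily γ Θ α)
    (hq : 1 - 2 * α + 2 * α * logDensity Θ < q) :
    ∃ C : ℝ, 0 < C ∧ ∀ᶠ Λ : ℝ in atTop, ∀ n : ℝ, ∀ h : ℝ → ℂ, MemLp h 2 volume →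
      ∃ M : ℝ → ENNReal, Measurable M ∧
        (∀ x, ∀ R ∈ Icc 0 Λ, ∀ t ∈ Icc (0 : ℝ) 1, ∀ θ ∈ Θ,
          ‖truncatedEvolution h R t (γ x t θ)‖ₑ ^ 2 ≤ M x) ∧
        ∫⁻ x in Icc n (n + 1), M x ≤ ENNReal.ofReal (C * Λ ^ q) * ∫⁻ ξ, ‖h ξ‖ₑ ^ 2 := by
  set d := q - (1 - 2 * α + 2 * α * logDensity Θ) with hd
  have hd0 : 0 < d := sub_pos.2 hq
  -- Taking ν ≥ 1-ε costs at most 2αε in the exponent and the covering number costs another 2αε;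
  -- together they use up the margin d = 4αε.
  set ε := d / (4 * α) with hε
  have hε0 : 0 < ε := by positivity
  have hεα : α * ε = d / 4 := by rw [hε]; field_simp
  set ν := max (1 / 2) (1 - ε) with hν
  have hν1 : ν < 1 := max_lt (by norm_num) (by linarith)
  have hνε : 1 - ε ≤ ν := le_max_right _ _
  have hexp : 1 - 2 * α * ν + 2 * α * (logDensity Θ + ε) ≤ q := by
    have : α * (1 - ε) ≤ α * ν := by gcongr
    nlinarith
  obtain ⟨C, hC, hmax⟩ := exists_maximal_of_diam_le hα hα' hγ (le_max_left (1 / 2) (1 - ε)) hν1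
  refine ⟨C, hC, ?_⟩
  have hlim : Tendsto (fun Λ : ℝ => Λ ^ (-(2 * α))) atTop (𝓝[>] 0) :=
    tendsto_nhdsWithin_iff.2 ⟨tendsto_rpow_neg_atTop (by positivity),
      (eventually_gt_atTop 0).mono fun Λ hΛ => Real.rpow_pos_of_pos hΛ _⟩
  filter_upwards [hlim.eventually (eventually_ballCoveringNumber_le_rpow hΘ
    (show logDensity Θ < logDensity Θ + ε by linarith)), eventually_ge_atTop 1] with Λ hN hΛ n h hh
  have hΛ0 : 0 < Λ := by linarith
  set δ := Λ ^ (-(2 * α)) with hδ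
  obtain ⟨T, hTcard, hT⟩ := exists_finset_card_eq_ballCoveringNumber hΘ
    (show 0 < δ from Real.rpow_pos_of_pos hΛ0 _)
  have hpiece : ∀ y : ℝ, ∃ M : ℝ → ENNReal, Measurable M ∧
        (∀ x, ∀ R ∈ Icc 0 Λ, ∀ t ∈ Icc (0 : ℝ) 1, ∀ θ ∈ Θ ∩ {θ | |θ - y| ≤ δ / 2},
          ‖truncatedEvolution h R t (γ x t θ)‖ₑ ^ 2 ≤ M x) ∧
        ∫⁻ x in Icc n (n + 1), M x ≤
          ENNReal.ofReal (C * Λ ^ (1 - 2 * α * ν)) * ∫⁻ ξ, ‖h ξ‖ₑ ^ 2 := fun y => by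
    refine hmax Λ hΛ (Θ ∩ {θ | |θ - y| ≤ δ / 2}) inter_subset_left ?_ n h hh
    rintro θ ⟨-, h1⟩ θ' ⟨-, h2⟩
    simp only [mem_ofPred_eq, abs_le] at h1 h2 ⊢
    constructor <;> linarith [h1.1, h1.2, h2.1, h2.2]
  choose M hMm hMb hMi using hpiece
  -- The supremum over Θ is bounded by the sum over the pieces, which costs the factor N(Λ^{-2α}).
  refine ⟨fun x => ∑ y ∈ T, M y x, Finset.measurable_fun_sum _ fun y _ => hMm y, ?_, ?_⟩
  · intro x R hR t ht θ hθ
    obtain ⟨y, hy, hd⟩ := hT θ hθ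
    exact (hMb y x R hR t ht θ ⟨hθ, hd⟩).trans
      (Finset.single_le_sum (f := fun y => M y x) (fun _ _ => bot_le) hy)
  · rw [lintegral_finsetSum _ fun y _ => hMm y]
    refine (Finset.sum_le_card_nsmul T _ _ fun y _ => hMi y).trans ?_
    rw [nsmul_eq_mul, ← mul_assoc]
    gcongr ?_ * _
    rw [← ENNReal.ofReal_natCast, ← ENNReal.ofReal_mul (Nat.cast_nonneg _)]
    refine ENNReal.ofReal_le_ofReal ?_
    have hN' : (T.card : ℝ) ≤ Λ ^ (2 * α * (logDensity Θ + ε)) := by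
      rw [hTcard]
      refine hN.trans (le_of_eq ?_)
      rw [hδ, ← Real.rpow_mul hΛ0.le]
      ring_nf
    calc (T.card : ℝ) * (C * Λ ^ (1 - 2 * α * ν))
        ≤ Λ ^ (2 * α * (logDensity Θ + ε)) * (C * Λ ^ (1 - 2 * α * ν)) := by gcongr
      _ = C * Λ ^ (1 - 2 * α * ν + 2 * α * (logDensity Θ + ε)) := by
          rw [Real.rpow_add hΛ0]; ring
      _ ≤ C * Λ ^ q := by gcongr

/-- Time differences on [0,1] are at most 1, so a smaller Hölder exponent is a weaker condition.
This reduces α > 1/4 to 1/4. -/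
theorem IsTangentialFamily.of_le {γ : ℝ → ℝ → ℝ → ℝ} {Θ : Set ℝ} {α α' : ℝ}
    (hγ : IsTangentialFamily γ Θ α) (hα' : 0 ≤ α') (h : α' ≤ α) : IsTangentialFamily γ Θ α' := by
  refine ⟨hγ.initial, hγ.contDiff, hγ.biLipschitz, ?_, hγ.lipschitz⟩
  obtain ⟨C₂, hC₂, hH⟩ := hγ.holder
  refine ⟨C₂, hC₂, fun x θ hθ t ht t' ht' => (hH x θ hθ t ht t' ht').trans ?_⟩
  have h1 : |t - t'| ≤ 1 := abs_le.2 ⟨by linarith [ht.1, ht'.2], by linarith [ht.2, ht'.1]⟩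
  gcongr C₂ * ?_
  exact Real.rpow_le_rpow_of_exponent_ge_of_imp (abs_nonneg _) h1 h (fun h0 h0' => by linarith)

/-! ### Dyadic summation and pointwise convergence -/

/-- The dyadic shell `2^k < |ξ| ≤ 2^{k+1}`, up to endpoints. -/
def dyadicShell (k : ℕ) : Set ℝ := Ioc (-2 ^ (k + 1)) (2 ^ (k + 1)) \ Ioc (-2 ^ k) (2 ^ k)

theorem measurableSet_dyadicShell (k : ℕ) : MeasurableSet (dyadicShell k) :=
  measurableSet_Ioc.diff measurableSet_Ioc

theorem le_abs_of_mem_dyadicShell {k : ℕ} {ξ : ℝ} (hξ : ξ ∈ dyadicShell k) : 2 ^ k ≤ |ξ| := by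
  by_contra! h
  rw [abs_lt] at h
  exact hξ.2 ⟨h.1, h.2.le⟩

/-- The increment from radius 2^k to R only sees frequencies in the shell, so it is itself a
truncated evolution and falls under the maximal estimate with Λ = 2^{k+1}. -/
theorem truncatedEvolution_sub_eq_shell {g : ℝ → ℂ} (hg : LocallyIntegrable g volume) {k : ℕ}
    {R : ℝ} (hR : R ∈ Icc (2 ^ k : ℝ) (2 ^ (k + 1))) (t y : ℝ) :
    truncatedEvolution g R t y - truncatedEvolution g (2 ^ k) t y =
      truncatedEvolution ((dyadicShell k).indicator g) R t y := by
  have h2 : (0 : ℝ) < 2 ^ k := by positivity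
  have hR0 : 0 < R := h2.trans_le hR.1
  have hsub : Ioc (-2 ^ k : ℝ) (2 ^ k) ⊆ Ioc (-R) R := Ioc_subset_Ioc (neg_le_neg hR.1) hR.1
  have hosc : Continuous (oscillation t y) :=
    continuous_oscillation.comp (by fun_prop : Continuous fun ξ : ℝ => (t, y, ξ))
  have hint : IntegrableOn (fun ξ => oscillation t y ξ * g ξ) (Ioc (-R) R) := by
    have hgR : IntegrableOn g (Ioc (-R) R) :=
      (hg.integrableOn_isCompact isCompact_Icc).mono_set Ioc_subset_Icc_self
    exact Integrable.bdd_mul (c := 1) hgR hosc.aestronglyMeasurable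
      (Eventually.of_forall fun ξ => (norm_oscillation _ _ _).le)
  simp only [truncatedEvolution]
  rw [intervalIntegral.integral_of_le (by linarith), intervalIntegral.integral_of_le (by linarith),
    intervalIntegral.integral_of_le (by linarith), ← setIntegral_sdiff measurableSet_Ioc hint hsub]
  simp_rw [← indicator_mul_right]
  rw [setIntegral_indicator (measurableSet_dyadicShell k)]
  congr 2
  ext ξ
  simp only [dyadicShell, Set.mem_sdiff, mem_inter_iff]
  constructor
  · rintro ⟨h1, h3⟩
    exact ⟨h1, Ioc_subset_Ioc (neg_le_neg hR.2) hR.2 h1, h3⟩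
  · rintro ⟨h1, -, h3⟩
    exact ⟨h1, h3⟩

theorem lintegral_enorm_sq_shell_le {g u : ℝ → ℂ} {s : ℝ} (hs : 0 ≤ s)
    (hgu : ∀ᵐ ξ : ℝ, g ξ = (((1 + ‖ξ‖ ^ 2) ^ (-s / 2) : ℝ) : ℂ) * u ξ) (k : ℕ) :
    ∫⁻ ξ, ‖(dyadicShell k).indicator g ξ‖ₑ ^ 2 ≤
      ENNReal.ofReal (((2 : ℝ) ^ k) ^ (-(2 * s))) * ∫⁻ ξ, ‖u ξ‖ₑ ^ 2 := by
  rw [← lintegral_const_mul' _ _ ENNReal.ofReal_ne_top]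
  refine lintegral_mono_ae (hgu.mono fun ξ hξ => ?_)
  by_cases h : ξ ∈ dyadicShell k
  · rw [indicator_of_mem h, hξ, enorm_mul, mul_pow]
    gcongr ?_ * _
    rw [← ofReal_norm, Complex.norm_real, Real.norm_of_nonneg (by positivity),
      ← ENNReal.ofReal_pow (by positivity)]
    refine ENNReal.ofReal_le_ofReal ?_
    have h1 : ((2 : ℝ) ^ k) ^ 2 ≤ 1 + ‖ξ‖ ^ 2 := by
      have h2 : (2 : ℝ) ^ k ≤ ‖ξ‖ := le_abs_of_mem_dyadicShell h
      have h3 : ((2 : ℝ) ^ k) ^ 2 ≤ ‖ξ‖ ^ 2 := by gcongr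
      linarith
    calc ((1 + ‖ξ‖ ^ 2) ^ (-s / 2)) ^ 2 = (1 + ‖ξ‖ ^ 2) ^ (-s) := by
          rw [← Real.rpow_natCast, ← Real.rpow_mul (by positivity)]
          congr 1; push_cast; ring
      _ ≤ (((2 : ℝ) ^ k) ^ 2) ^ (-s) :=
          Real.rpow_le_rpow_of_nonpos (by positivity) h1 (by linarith)
      _ = _ := by
          rw [← Real.rpow_natCast, ← Real.rpow_mul (by positivity)]
          congr 1; push_cast; ring
  · rw [indicator_of_notMem h]
    simp

/-- Almost every point has a geometric rate of convergence of the Fourier integrals, uniform over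
its approach region. -/
theorem ae_exists_geometric_bound {γ : ℝ → ℝ → ℝ → ℝ} {Θ : Set ℝ} (hΘ : IsCompact Θ) {α s : ℝ}
    (hα : 0 < α) (hα' : α ≤ 1 / 4) (hγ : IsTangentialFamily γ Θ α) (hs : 0 ≤ s)
    (hsβ : 1 - 2 * α + 2 * α * logDensity Θ < 2 * s) {g u : ℝ → ℂ} (hg : MemLp g 2 volume)
    (hu : MemLp u 2 volume)
    (hgu : ∀ᵐ ξ : ℝ, g ξ = (((1 + ‖ξ‖ ^ 2) ^ (-s / 2) : ℝ) : ℂ) * u ξ) :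
    ∃ r ∈ Ioo (0 : ℝ) 1, ∃ k₀ : ℕ, ∀ᵐ x : ℝ, ∃ B : ℝ, ∀ k ≥ k₀,
      ∀ R ∈ Icc (2 ^ k : ℝ) (2 ^ (k + 1)), ∀ t ∈ Icc (0 : ℝ) 1, ∀ θ ∈ Θ,
      ‖truncatedEvolution g R t (γ x t θ) - truncatedEvolution g (2 ^ k) t (γ x t θ)‖ ≤
        B * r ^ k := by
  obtain ⟨q, hq, hqs⟩ := exists_between hsβ
  obtain ⟨C, hC, hmax⟩ := exists_maximal hΘ hα hα' hγ hq
  set a := 2 * s - q with ha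
  have ha0 : 0 < a := sub_pos.2 hqs
  -- The squared shell norms decay like 2^{-ak} = r^{4k}. Weighting them by r^{-2k} leaves the
  -- summable r^{2k}, and a finite weighted sum bounds each increment by a multiple of r^k.
  set r : ℝ := 2 ^ (-(a / 4)) with hr
  have hr0 : 0 < r := by positivity
  have hr1 : r < 1 := Real.rpow_lt_one_of_one_lt_of_neg (by norm_num) (by linarith)
  have hpow : Tendsto (fun k : ℕ => (2 : ℝ) ^ (k + 1)) atTop atTop :=
    (tendsto_pow_atTop_atTop_of_one_lt one_lt_two).comp (tendsto_add_atTop_nat 1)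
  obtain ⟨k₀, hk₀⟩ := eventually_atTop.1 (hpow.eventually hmax)
  have hloc : LocallyIntegrable g volume := hg.locallyIntegrable (by norm_num)
  have hshell : ∀ k, MemLp ((dyadicShell k).indicator g) 2 volume := fun k =>
    hg.indicator (measurableSet_dyadicShell k)
  set U := ∫⁻ ξ, ‖u ξ‖ₑ ^ 2 with hU
  have hUtop : U ≠ ⊤ := by
    have := lintegral_rpow_enorm_lt_top_of_eLpNorm_lt_top (p := 2) (by norm_num) (by norm_num) hu.2
    simpa using this.ne
  refine ⟨r, ⟨hr0, hr1⟩, k₀, ?_⟩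
  have hunit : ∀ n : ℤ, ∀ᵐ x ∂(volume.restrict (Icc (n : ℝ) (n + 1))), ∃ B : ℝ, ∀ k ≥ k₀,
      ∀ R ∈ Icc (2 ^ k : ℝ) (2 ^ (k + 1)), ∀ t ∈ Icc (0 : ℝ) 1, ∀ θ ∈ Θ,
      ‖truncatedEvolution g R t (γ x t θ) - truncatedEvolution g (2 ^ k) t (γ x t θ)‖ ≤
        B * r ^ k := by
    intro n
    have hk : ∀ k : ℕ, ∃ M : ℝ → ENNReal, Measurable M ∧
        (k₀ ≤ k → ∀ x, ∀ R ∈ Icc (0 : ℝ) (2 ^ (k + 1)), ∀ t ∈ Icc (0 : ℝ) 1, ∀ θ ∈ Θ,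
          ‖truncatedEvolution ((dyadicShell k).indicator g) R t (γ x t θ)‖ₑ ^ 2 ≤ M x) ∧
        ∫⁻ x in Icc (n : ℝ) (n + 1), M x ≤
          ENNReal.ofReal (C * (2 ^ (k + 1) : ℝ) ^ q * ((2 : ℝ) ^ k) ^ (-(2 * s))) * U := by
      intro k
      by_cases hkk : k₀ ≤ k
      · obtain ⟨M, hM, hMb, hMi⟩ := hk₀ k hkk n _ (hshell k)
        refine ⟨M, hM, fun _ => hMb, hMi.trans ?_⟩
        rw [ENNReal.ofReal_mul (p := C * (2 ^ (k + 1)) ^ q) (by positivity), mul_assoc]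
        gcongr
        exact lintegral_enorm_sq_shell_le hs hgu k
      · exact ⟨fun _ => 0, measurable_const, fun h => absurd h hkk, by simp⟩
    choose M hM hMb hMi using hk
    have hterm : ∀ k : ℕ, (r⁻¹ ^ k) ^ 2 * (C * (2 ^ (k + 1) : ℝ) ^ q * ((2 : ℝ) ^ k) ^ (-(2 * s))) =
        C * 2 ^ q * (r ^ 2) ^ k := by
      intro k
      have e1 : (2 ^ (k + 1) : ℝ) ^ q = 2 ^ q * (2 ^ q) ^ k := by
        rw [pow_succ, Real.mul_rpow (by positivity) (by norm_num), ← Real.rpow_natCast,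
          ← Real.rpow_natCast, ← Real.rpow_mul (by norm_num), ← Real.rpow_mul (by norm_num),
          mul_comm (k : ℝ), mul_comm]
      have e2 : ((2 : ℝ) ^ k) ^ (-(2 * s)) = (2 ^ (-(2 * s))) ^ k := by
        rw [← Real.rpow_natCast, ← Real.rpow_natCast, ← Real.rpow_mul (by norm_num),
          ← Real.rpow_mul (by norm_num), mul_comm]
      have e3 : (2 : ℝ) ^ q * 2 ^ (-(2 * s)) = r ^ 2 * r ^ 2 := by
        rw [hr, ← Real.rpow_natCast, ← Real.rpow_mul (by norm_num), ← Real.rpow_add (by norm_num),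
          ← Real.rpow_add (by norm_num)]
        congr 1; rw [ha]; push_cast; ring
      calc _ = C * 2 ^ q * ((r⁻¹ ^ 2) * ((2 : ℝ) ^ q * 2 ^ (-(2 * s)))) ^ k := by
            rw [e1, e2, mul_pow, mul_pow, ← pow_mul, ← pow_mul, mul_comm k 2]; ring
        _ = _ := by rw [e3]; congr 2; field_simp
    -- A finite integral makes the weighted sum finite almost everywhere; B is the square root of
    -- that sum.
    have hsum : ∫⁻ x in Icc (n : ℝ) (n + 1), ∑' k, ENNReal.ofReal ((r⁻¹ ^ k) ^ 2) * M k x < ⊤ := by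
      rw [lintegral_tsum fun k => ((hM k).const_mul _).aemeasurable]
      have hle : ∀ k, ∫⁻ x in Icc (n : ℝ) (n + 1), ENNReal.ofReal ((r⁻¹ ^ k) ^ 2) * M k x ≤
          ENNReal.ofReal (C * 2 ^ q * (r ^ 2) ^ k) * U := by
        intro k
        rw [lintegral_const_mul _ (hM k), ← hterm k, ENNReal.ofReal_mul (by positivity), mul_assoc]
        gcongr
        exact hMi k
      refine (ENNReal.tsum_le_tsum hle).trans_lt ?_
      rw [ENNReal.tsum_mul_right]
      refine ENNReal.mul_lt_top ?_ hUtop.lt_top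
      have hsm : Summable fun k : ℕ => C * 2 ^ q * (r ^ 2) ^ k :=
        (summable_geometric_of_lt_one (by positivity) (by nlinarith)).mul_left _
      rw [← ENNReal.ofReal_tsum_of_nonneg (fun k => by positivity) hsm]
      exact ENNReal.ofReal_lt_top
    have hae := ae_lt_top (Measurable.tsum fun k => (hM k).const_mul _) hsum.ne
    filter_upwards [hae] with x hx
    set S := ∑' k, ENNReal.ofReal ((r⁻¹ ^ k) ^ 2) * M k x with hS
    refine ⟨√S.toReal, fun k hk R hR t ht θ hθ => ?_⟩
    rw [truncatedEvolution_sub_eq_shell hloc hR]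
    set v := truncatedEvolution ((dyadicShell k).indicator g) R t (γ x t θ) with hv
    have h1 : ‖v‖ₑ ^ 2 ≤ M k x :=
      hMb k hk x R ⟨by linarith [hR.1, pow_pos (two_pos : (0 : ℝ) < 2) k], hR.2⟩ t ht θ hθ
    have h2 : ENNReal.ofReal ((r⁻¹ ^ k) ^ 2) * ‖v‖ₑ ^ 2 ≤ S :=
      (mul_le_mul_right h1 _).trans
        (ENNReal.le_tsum (f := fun k => ENNReal.ofReal ((r⁻¹ ^ k) ^ 2) * M k x) k)
    rw [← ofReal_norm, ← ENNReal.ofReal_pow (norm_nonneg _), ← ENNReal.ofReal_mul (by positivity),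
      ← mul_pow] at h2
    have h3 : (r⁻¹ ^ k * ‖v‖) ^ 2 ≤ S.toReal :=
      (ENNReal.ofReal_le_iff_le_toReal hx.ne).1 h2
    have h4 : r⁻¹ ^ k * ‖v‖ ≤ √S.toReal := Real.le_sqrt_of_sq_le h3
    rw [inv_pow, inv_mul_le_iff₀ (by positivity)] at h4
    linarith
  have hcover : (⋃ n : ℤ, Icc (n : ℝ) (n + 1)) = univ :=
    eq_univ_of_forall fun x => mem_iUnion.2 ⟨⌊x⌋, Int.floor_le x, (Int.lt_floor_add_one x).le⟩
  rw [← Measure.restrict_univ (μ := (volume : Measure ℝ)), ← hcover]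
  exact (ae_restrict_iUnion_iff _ _).2 hunit

/-- Telescope along powers of 2 up to the block containing R, then make one partial step inside that
block; the total is a partial sum of the geometric series. -/
theorem norm_sub_le_of_dyadic_geometric {F : ℝ → ℂ} {B r : ℝ} (hr : r ∈ Ioo (0 : ℝ) 1) {k₀ : ℕ}
    (hF : ∀ k ≥ k₀, ∀ R ∈ Icc (2 ^ k : ℝ) (2 ^ (k + 1)), ‖F R - F (2 ^ k)‖ ≤ B * r ^ k)
    {k : ℕ} (hk : k₀ ≤ k) {R : ℝ} (hR : 2 ^ k ≤ R) : ‖F R - F (2 ^ k)‖ ≤ B * r ^ k / (1 - r) := by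
  have hB : 0 ≤ B := by
    have h := (norm_nonneg _).trans (hF k₀ le_rfl (2 ^ k₀) ⟨le_rfl, pow_le_pow_right₀ one_le_two (Nat.le_succ _)⟩)
    exact nonneg_of_mul_nonneg_left h (pow_pos hr.1 _)
  have h1r : 0 < 1 - r := sub_pos.2 hr.2
  obtain ⟨m, hm1, hm2⟩ := exists_nat_pow_near
    ((one_le_pow₀ (one_le_two : (1 : ℝ) ≤ 2)).trans hR) (one_lt_two : (1 : ℝ) < 2)
  have hkm : k ≤ m := by
    have : (2 : ℝ) ^ k < 2 ^ (m + 1) := hR.trans_lt hm2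
    exact Nat.lt_succ_iff.1 ((pow_lt_pow_iff_right₀ one_lt_two).1 this)
  have hind : ∀ j, ‖F (2 ^ (k + j)) - F (2 ^ k)‖ ≤ B * r ^ k * ∑ i ∈ Finset.range j, r ^ i := by
    intro j
    induction j with
    | zero => simp
    | succ j ih =>
      have h1 := hF (k + j) (by omega) (2 ^ (k + j + 1)) ⟨pow_le_pow_right₀ one_le_two (Nat.le_succ _), le_rfl⟩
      rw [Finset.sum_range_succ, mul_add]
      calc ‖F (2 ^ (k + (j + 1))) - F (2 ^ k)‖ ≤ ‖F (2 ^ (k + j + 1)) - F (2 ^ (k + j))‖ +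
            ‖F (2 ^ (k + j)) - F (2 ^ k)‖ := norm_sub_le_norm_sub_add_norm_sub _ _ _
        _ ≤ _ := by rw [pow_add r] at h1; linarith
  obtain ⟨j, rfl⟩ := Nat.exists_eq_add_of_le hkm
  have h1 := hF (k + j) (by omega) R ⟨hm1, hm2.le⟩
  have h2 : ∑ i ∈ Finset.range (j + 1), r ^ i ≤ (1 - r)⁻¹ := by
    rw [← tsum_geometric_of_lt_one hr.1.le hr.2]
    exact (summable_geometric_of_lt_one hr.1.le hr.2).sum_le_tsum _ fun i _ => pow_nonneg hr.1.le _
  calc ‖F R - F (2 ^ k)‖ ≤ ‖F R - F (2 ^ (k + j))‖ + ‖F (2 ^ (k + j)) - F (2 ^ k)‖ :=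
        norm_sub_le_norm_sub_add_norm_sub _ _ _
    _ ≤ B * r ^ k * ∑ i ∈ Finset.range (j + 1), r ^ i := by
        rw [Finset.sum_range_succ, mul_add]
        have := hind j
        rw [pow_add r] at h1
        linarith
    _ ≤ B * r ^ k * (1 - r)⁻¹ := by
        have := hr.1
        gcongr
    _ = _ := by rw [div_eq_mul_inv]

/-- The convergence theorem for Hölder exponents at most `1/4`. -/
theorem convergesAlong_of_memHs {γ : ℝ → ℝ → ℝ → ℝ} {Θ : Set ℝ} (hΘ : IsCompact Θ) {α s : ℝ}
    (hα : 0 < α) (hα' : α ≤ 1 / 4) (hγ : IsTangentialFamily γ Θ α)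
    (hs : α * logDensity Θ + 1 / 2 - α < s) {f : Lp ℂ 2 (volume : Measure ℝ)} (hf : MemHs s f) :
    ConvergesAlong γ Θ f := by
  have hs0 : 0 ≤ s := by
    have := mul_nonneg hα.le (logDensity_nonneg hΘ)
    linarith
  obtain ⟨u, hu⟩ := hf.exists_fourier_eq hs0
  set g : Lp ℂ 2 (volume : Measure ℝ) := 𝓕 f with hg
  obtain ⟨r, hr, k₀, hae⟩ := ae_exists_geometric_bound hΘ hα hα' hγ hs0 (by linarith)
    (Lp.memLp g) (Lp.memLp u) hu
  obtain ⟨N, hN, hNae⟩ := exists_seq_tendsto_truncatedEvolution_zero f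
  filter_upwards [hae, hNae] with x ⟨B, hB⟩ hx0
  set E : ℕ → ℝ := fun k => B * r ^ k / (1 - r) with hE
  have hElim : Tendsto E atTop (𝓝 0) := by
    have := ((tendsto_pow_atTop_nhds_zero_of_lt_one hr.1.le hr.2).const_mul B).div_const (1 - r)
    simpa using this
  have hunif : ∀ t ∈ Icc (0 : ℝ) 1, ∀ θ ∈ Θ, ∀ k ≥ k₀, ∀ R : ℝ, 2 ^ k ≤ R →
      ‖truncatedEvolution g R t (γ x t θ) - truncatedEvolution g (2 ^ k) t (γ x t θ)‖ ≤ E k :=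
    fun t ht θ hθ k hk R hR => norm_sub_le_of_dyadic_geometric
      (F := fun R => truncatedEvolution g R t (γ x t θ)) hr
      (fun j hj R hR => hB j hj R hR t ht θ hθ) hk hR
  have hex : ∀ t ∈ Icc (0 : ℝ) 1, ∀ θ ∈ Θ, ∃ v : ℂ, HasSchrodingerValue f t (γ x t θ) v := by
    intro t ht θ hθ
    refine cauchySeq_tendsto_of_complete (Metric.cauchySeq_iff'.2 fun ε hε => ?_)
    obtain ⟨k, hk1, hk2⟩ := ((hElim.eventually (gt_mem_nhds hε)).and
      (eventually_ge_atTop k₀)).exists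
    refine ⟨2 ^ k, fun R hR => ?_⟩
    rw [dist_eq_norm]
    exact (hunif t ht θ hθ k hk2 R hR).trans_lt hk1
  have hval : ∀ t ∈ Icc (0 : ℝ) 1, ∀ θ ∈ Θ, ∀ k ≥ k₀,
      ‖schrodinger f t (γ x t θ) - truncatedEvolution g (2 ^ k) t (γ x t θ)‖ ≤ E k := by
    intro t ht θ hθ k hk
    obtain ⟨v, hv⟩ := hex t ht θ hθ
    have hv' : Tendsto (fun R => truncatedEvolution g R t (γ x t θ)) atTop (𝓝 v) := hv
    have : schrodinger f t (γ x t θ) = v := hv.limUnder_eq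
    rw [this]
    exact le_of_tendsto (hv'.sub_const _).norm
      ((eventually_ge_atTop (2 ^ k)).mono fun R hR => hunif t ht θ hθ k hk R hR)
  refine ⟨?_, ?_⟩
  · rintro ⟨y, t⟩ ⟨ht, θ, hθ, hy⟩
    have hy' : γ x t θ = y := hy
    subst hy'
    exact hex t ⟨ht.1.le, ht.2⟩ θ hθ
  -- A parameter θ₀ is needed to reach the point (x, 0); without one the approach region is empty.
  · rcases Θ.eq_empty_or_nonempty with rfl | ⟨θ₀, hθ₀⟩
    · have : approachRegion γ ∅ x = ∅ := by
        ext q; simp [approachRegion, curveSection]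
      rw [this, nhdsWithin_empty]
      exact tendsto_bot
    -- As γ(x, 0, θ₀) = x, the uniform bound at t = 0 controls the truncations at x itself, and the
    -- subsequence converging to f(x) passes it to the limit.
    have hfx : ∀ k ≥ k₀, ‖f x - truncatedEvolution g (2 ^ k) 0 x‖ ≤ E k := by
      intro k hk
      refine le_of_tendsto (hx0.sub_const _).norm ?_
      have hNt : Tendsto (fun j => (N j : ℝ)) atTop atTop :=
        tendsto_natCast_atTop_atTop.comp hN.tendsto_atTop
      filter_upwards [hNt.eventually_ge_atTop (2 ^ k)] with j hj
      have := hunif 0 ⟨le_rfl, zero_le_one⟩ θ₀ hθ₀ k hk _ hj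
      rwa [hγ.initial x θ₀ hθ₀] at this
    rw [Metric.tendsto_nhds]
    intro ε hε
    obtain ⟨k, hk1, hk2⟩ := ((hElim.eventually (gt_mem_nhds (show 0 < ε / 3 by linarith))).and
      (eventually_ge_atTop k₀)).exists
    have hcont : Continuous fun q : ℝ × ℝ => truncatedEvolution g (2 ^ k) q.2 q.1 :=
      (continuousOn_truncatedEvolution ((Lp.memLp g).locallyIntegrable (by norm_num))).comp_continuous
        (f := fun q : ℝ × ℝ => ((2 : ℝ) ^ k, q.2, q.1)) (by fun_prop)
        fun q => ⟨show (0 : ℝ) ≤ 2 ^ k by positivity, mem_univ _⟩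
    have hnear : ∀ᶠ q in 𝓝[approachRegion γ Θ x] (x, (0 : ℝ)),
        dist (truncatedEvolution g (2 ^ k) q.2 q.1) (truncatedEvolution g (2 ^ k) 0 x) < ε / 3 :=
      nhdsWithin_le_nhds (Metric.tendsto_nhds.1 (hcont.tendsto (x, (0 : ℝ))) _ (by linarith))
    filter_upwards [hnear, self_mem_nhdsWithin] with q hq hmem
    obtain ⟨ht, θ, hθ, hy⟩ := hmem
    have h1 := hval q.2 ⟨ht.1.le, ht.2⟩ θ hθ k hk2
    have hy' : γ x q.2 θ = q.1 := hy
    rw [hy', ← dist_eq_norm] at h1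
    have h2 := hfx k hk2
    rw [← dist_eq_norm, dist_comm] at h2
    have h3 := dist_triangle4 (schrodinger f q.2 q.1) (truncatedEvolution g (2 ^ k) q.2 q.1)
      (truncatedEvolution g (2 ^ k) 0 x) (f x)
    linarith

end TangentialSchrodinger

theorem mainTheorem9 (γ : ℝ → ℝ → ℝ → ℝ) (Θ : Set ℝ) (hΘ : IsCompact Θ)
    (α : ℝ) (hα : α ∈ Set.Ioo (0 : ℝ) 1)
    (hγ : TangentialSchrodinger.IsTangentialFamily γ Θ α) :
    (α ∈ Set.Ioo (1 / 4 : ℝ) 1 →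
      ∀ s : ℝ, (TangentialSchrodinger.logDensity Θ + 1) / 4 < s →
      ∀ f : MeasureTheory.Lp ℂ 2 (MeasureTheory.volume : MeasureTheory.Measure ℝ),
        TangentialSchrodinger.MemHs s f → TangentialSchrodinger.ConvergesAlong γ Θ f) ∧
    (α ∈ Set.Ioc (0 : ℝ) (1 / 4) →
      ∀ s : ℝ, α * TangentialSchrodinger.logDensity Θ + 1 / 2 - α < s →
      ∀ f : MeasureTheory.Lp ℂ 2 (MeasureTheory.volume : MeasureTheory.Measure ℝ),
        TangentialSchrodinger.MemHs s f → TangentialSchrodinger.ConvergesAlong γ Θ f) := by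
  refine ⟨fun hα4 s hs f hf => ?_, fun hα4 s hs f hf => ?_⟩
  -- At α = 1/4 the threshold αβ + 1/2 - α equals (β + 1)/4.
  · exact TangentialSchrodinger.convergesAlong_of_memHs hΘ (by norm_num : (0 : ℝ) < 1 / 4) le_rfl
      (hγ.of_le (by norm_num) hα4.1.le) (by linarith) hf
  · exact TangentialSchrodinger.convergesAlong_of_memHs hΘ hα4.1 hα4.2 hγ hs hf
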